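/- **Setting.** Let $K$ be a compact metric space with a Borel probability measure $\mu$ and a closed set $\partial K\subset K$ (the boundary) with $\mu(\partial K)=0$. Let $(\mathcal E^\vee,\mathcal F^\vee)$ be a local regular Dirichlet form on $L^2(K,\mu)$; its self-adjoint operator $-\Delta^\vee$ is the Neumann Laplacian of the cell. The Dirichlet Laplacian $-\Delta^\wedge$ is the operator of the restriction of $\mathcal E^\vee$ to $\mathcal F^\wedge$, the closure in $\mathcal F^\vee$ (for the norm $(\mathcal E^\vee(u,u)+\|u\|^2)^{1/2}$) of the continuous functions of $\mathcal F^\vee$ with compact support in $K\setminus\partial K$. Both operators are assumed to have compact resolvent. For an operator $A$ with discrete spectrum let $\#\{\lambda_i(A)\le\lambda\}$ be the number of its eigenvalues $\le\lambda$, counted with multiplicity, and put $N^{\rm b}(K,\mu,\lambda)=\#\{\lambda_i(-\Delta^{\rm b})\le\lambda\}$, ${\rm b}\in\{\wedge,\vee\}$. Let $K_\infty$ be a metric space with metric $d$ and origin $0$, and $K_\infty=\bigcup_\alpha K_\alpha$, where $\varphi_\alpha:K\to K_\alpha$ is a surjective isometry for each $\alpha$ and $K_\alpha\cap K_{\alpha'}=\varphi_\alpha(\partial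 K)\cap\varphi_{\alpha'}(\partial K)$ for $\alpha\ne\alpha'$. Let $\mu_\infty=\sum_\alpha\mu\circ\varphi_\alpha^{-1}$, and assume that balls have finite $\mu_\infty$-measure. Let $(\widetilde{\mathcal E},\widetilde{\mathcal F})$ be a local regular Dirichlet form on $L^2(K_\infty,\mu_\infty)$, with self-adjoint operator $-\Delta$, which is glued from the cell form: (a) if $u,v\in\widetilde{\mathcal F}$, then $u\circ\varphi_\alpha,v\circ\varphi_\alpha\in\mathcal F^\vee$ for all $\alpha$ and $\widetilde{\mathcal E}(u,v)=\sum_\alpha\mathcal E^\vee(u\circ\varphi_\alpha,v\circ\varphi_\alpha)$; (b) if $u\in L^2(K_\infty,\mu_\infty)$ vanishes off one cell $K_\alpha$ and $u\circ\varphi_\alpha\in\mathcal F^\wedge$, then $u\in\widetilde{\mathcal F}$. Let $V:K_\infty\to[0,\infty)$ be measurable and locally bounded. Let $V^\wedge$ (resp. $V^\vee$) be the function equal to $\sup_{K_\alpha}V$ (resp. $\inf_{K_\alpha}V$) on each cell $K_\alpha$ (where several cells meet, a $\mu_\infty$-null set, the largest, resp. smallest, of these values is taken), and put $$F(V,\lambda)=\mu_\infty\{V\le\lambda\},\qquad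 F^{\rm b}(V,\lambda)=\mu_\infty\{V^{\rm b}\le\lambda\},\quad {\rm b}\in\{\wedge,\vee\}.$$ **Theorem (existence of spectral dimension).** Assume: 1. there is $d_s>0$ such that, for both ${\rm b}\in\{\wedge,\vee\}$, $$0<\liminf_{\lambda\to\infty}\lambda^{-d_s/2}N^{\rm b}(K,\mu,\lambda)\le\limsup_{\lambda\to\infty}\lambda^{-d_s/2}N^{\rm b}(K,\mu,\lambda)<\infty;$$ 2. $V(x)\to+\infty$ as $d(0,x)\to+\infty$; 3. there is $C>0$ such that $F^\vee(V,2\lambda)\le C\,F^\wedge(V,\lambda)$ for all sufficiently large $\lambda$. Then the Schrödinger operator $-\Delta+V$, defined as a sum of quadratic forms, is self-adjoint on $L^2(K_\infty,\mu_\infty)$ with compact resolvent, and its eigenvalue counting function $N(K_\infty,\mu_\infty,V,\lambda)=\#\{\lambda_i(-\Delta+V)\le\lambda\}$ satisfies $$0<\liminf_{\lambda\to\infty}\frac{N(K_\infty,\mu_\infty,V,\lambda)}{\lambda^{d_s/2}F(V,\lambda)}\le\limsup_{\lambda\to\infty}\frac{N(K_\infty,\mu_\infty,V,\lambda)}{\lambda^{d_s/2}F(V,\lambda)}<\infty.$$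 In particular, if $F(V,\lambda)=\Theta(\lambda^\beta)$ as $\lambda\to\infty$ for some real $\beta$, then $d_s+2\beta$ is the spectral dimension of $-\Delta+V$, that is, $$0<\liminf_{\lambda\to\infty}\lambda^{-(d_s+2\beta)/2}N(K_\infty,\mu_\infty,V,\lambda)\le\limsup_{\lambda\to\infty}\lambda^{-(d_s+2\beta)/2}N(K_\infty,\mu_\infty,V,\lambda)<\infty.$$ -/

import Mathlib

open MeasureTheory Filter Topology
open scoped ENNReal NNReal

noncomputable section

/-! Nonnegative symmetric forms on a real Hilbert space and the operators they represent. -/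

/-- A nonnegative symmetric bilinear form `form` on `H` with form domain `domain`. -/
structure NonnegForm (H : Type*) [NormedAddCommGroup H] [InnerProductSpace ℝ H] where
  domain : Submodule ℝ H
  form : domain →ₗ[ℝ] domain →ₗ[ℝ] ℝ
  symm : ∀ u v, form u v = form v u
  nonneg : ∀ u, 0 ≤ form u u

namespace NonnegForm

variable {H : Type*} [NormedAddCommGroup H] [InnerProductSpace ℝ H]

/-- The squared form norm `E₁(u) = E(u,u) + ‖u‖²`. -/
def normSq (E : NonnegForm H) (u : E.domain) : ℝ := E.form u u + ‖(u : H)‖ ^ 2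

/-- Closedness: a form-Cauchy sequence of the domain that converges in `H` has its limit in the
domain and converges to it in the form norm. -/
def Closed (E : NonnegForm H) : Prop :=
  ∀ (u : ℕ → E.domain) (x : H), Tendsto (fun n => (u n : H)) atTop (𝓝 x) →
    (∀ ε > 0, ∃ N, ∀ m ≥ N, ∀ n ≥ N, E.form (u m - u n) (u m - u n) < ε) →
    ∃ y : E.domain, (y : H) = x ∧ Tendsto (fun n => E.form (u n - y) (u n - y)) atTop (𝓝 0)

/-- The form is closed and densely defined, i.e. it is the form of a nonnegative self-adjoint
operator `A` on `H`. -/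
def DenselyDefinedClosed (E : NonnegForm H) : Prop :=
  Dense (E.domain : Set H) ∧ E.Closed

/-- `E.OpEq u f` says that `u` lies in the domain of the operator `A` represented by the form and
`A u = f`: `u` is in the form domain and `E(u, v) = ⟨f, v⟩` for all `v` in the form domain. -/
def OpEq (E : NonnegForm H) (u f : H) : Prop :=
  ∃ hu : u ∈ E.domain, ∀ v : E.domain, E.form ⟨u, hu⟩ v = inner ℝ f (v : H)

/-- The operator `A` has compact resolvent: `(A + 1)⁻¹` is an everywhere defined
compact operator. -/
def CompactResolvent (E : NonnegForm H) : Prop :=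
  ∃ G : H →L[ℝ] H, IsCompactOperator G ∧ ∀ f, E.OpEq (G f) (f - G f)

/-- The eigenvalue counting function `#{i : lᵢ(A) ≤ l}`, eigenvalues being repeated according to
their multiplicity: the dimension of the span of all eigenvectors `A u = k u` with `k ≤ l`
(eigenspaces of different eigenvalues are orthogonal). -/
def count (E : NonnegForm H) (l : ℝ) : ℝ≥0∞ :=
  ((Cardinal.toENat (Module.rank ℝ
    (Submodule.span ℝ {u : H | ∃ k ≤ l, E.OpEq u (k • u)})) : ℕ∞) : ℝ≥0∞)

/-- The form sum, on the intersection of the two form domains. -/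
def add (E Q : NonnegForm H) : NonnegForm H where
  domain := E.domain ⊓ Q.domain
  form :=
    E.form.compl₁₂ (Submodule.inclusion inf_le_left) (Submodule.inclusion inf_le_left) +
      Q.form.compl₁₂ (Submodule.inclusion inf_le_right) (Submodule.inclusion inf_le_right)
  symm u v := by
    simp only [LinearMap.add_apply, LinearMap.compl₁₂_apply]
    rw [E.symm, Q.symm]
  nonneg u := by
    simp only [LinearMap.add_apply, LinearMap.compl₁₂_apply]
    exact add_nonneg (E.nonneg _) (Q.nonneg _)

/-- The restriction of the form to a smaller domain. -/
def restrictTo (E : NonnegForm H) (D : Submodule ℝ H) (hD : D ≤ E.domain) : NonnegForm H where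
  domain := D
  form := E.form.compl₁₂ (Submodule.inclusion hD) (Submodule.inclusion hD)
  symm u v := by
    simp only [LinearMap.compl₁₂_apply]
    rw [E.symm]
  nonneg u := by
    simp only [LinearMap.compl₁₂_apply]
    exact E.nonneg _

theorem normSq_add_le (E : NonnegForm H) (u v : E.domain) :
    E.normSq (u + v) ≤ 2 * E.normSq u + 2 * E.normSq v := by
  have h1 := E.nonneg (u - v)
  have h2 := parallelogram_law_with_norm ℝ (u : H) (v : H)
  simp only [normSq, map_add, map_sub, LinearMap.add_apply, LinearMap.sub_apply,
    Submodule.coe_add] at *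
  nlinarith [sq_nonneg ‖(u : H) - (v : H)‖]

theorem normSq_smul (E : NonnegForm H) (c : ℝ) (u : E.domain) :
    E.normSq (c • u) = c ^ 2 * E.normSq u := by
  simp only [normSq, map_smul, LinearMap.smul_apply, Submodule.coe_smul, norm_smul, smul_eq_mul,
    mul_pow, Real.norm_eq_abs, sq_abs]
  ring

end NonnegForm

/-! Dirichlet forms on `L²(X, m)`. -/

section DirichletForms

variable {X : Type*} [TopologicalSpace X] [MeasurableSpace X] {m : Measure X}

/-- The class `u` has a continuous representative with compact support inside `G`. -/
def HasCcRep (G : Set X) (u : Lp ℝ 2 m) : Prop :=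
  ∃ f : X → ℝ, Continuous f ∧ HasCompactSupport f ∧ tsupport f ⊆ G ∧ u =ᵐ[m] f

/-- The support of the measure `|u| m`. -/
def classSupport (u : Lp ℝ 2 m) : Set X :=
  {x | ∀ U ∈ 𝓝 x, m (U ∩ {y | u y ≠ 0}) ≠ 0}

/-- A Dirichlet form: closed, densely defined, and the unit contraction operates on it. -/
def IsDirichletForm (E : NonnegForm (Lp ℝ 2 m)) : Prop :=
  E.DenselyDefinedClosed ∧
  ∀ (u : E.domain) (w : Lp ℝ 2 m), w =ᵐ[m] (fun x => max 0 (min ((u : Lp ℝ 2 m) x) 1)) →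
    ∃ hw : w ∈ E.domain, E.form ⟨w, hw⟩ ⟨w, hw⟩ ≤ E.form u u

/-- Regularity: the compactly supported continuous functions of the domain are dense in the
domain for the form norm, and uniformly dense in `C_c(X)`. -/
def IsRegularForm (E : NonnegForm (Lp ℝ 2 m)) : Prop :=
  (∀ u : E.domain, ∀ ε > 0, ∃ w : E.domain,
    HasCcRep Set.univ (w : Lp ℝ 2 m) ∧ E.normSq (u - w) < ε) ∧
  (∀ f : X → ℝ, Continuous f → HasCompactSupport f → ∀ ε > 0, ∃ g : X → ℝ,
    Continuous g ∧ HasCompactSupport g ∧ (∃ w : E.domain, (w : Lp ℝ 2 m) =ᵐ[m] g) ∧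
      ∀ x, |f x - g x| < ε)

/-- Locality: `E(u, v) = 0` when `u` and `v` have disjoint compact supports. -/
def IsLocalForm (E : NonnegForm (Lp ℝ 2 m)) : Prop :=
  ∀ u v : E.domain, IsCompact (classSupport (u : Lp ℝ 2 m)) →
    IsCompact (classSupport (v : Lp ℝ 2 m)) →
    Disjoint (classSupport (u : Lp ℝ 2 m)) (classSupport (v : Lp ℝ 2 m)) → E.form u v = 0

/-- A local regular Dirichlet form on `L²(X, m)`, i.e. a self-adjoint Laplacian. -/
structure IsLaplacianForm (E : NonnegForm (Lp ℝ 2 m)) : Prop where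
  dirichlet : IsDirichletForm E
  regular : IsRegularForm E
  isLocal : IsLocalForm E

/-- The closure, for the form norm, of the functions of the form domain that are continuous with
compact support in `G`. -/
def partDomain (E : NonnegForm (Lp ℝ 2 m)) (G : Set X) : Submodule ℝ (Lp ℝ 2 m) where
  carrier := {u | ∃ hu : u ∈ E.domain, ∀ ε > 0, ∃ w : E.domain,
    HasCcRep G (w : Lp ℝ 2 m) ∧ E.normSq (⟨u, hu⟩ - w) < ε}
  zero_mem' := by
    refine ⟨E.domain.zero_mem, fun ε hε => ⟨0, ⟨fun _ => 0, continuous_const,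
      HasCompactSupport.zero, ?_, ?_⟩, ?_⟩⟩
    · have : tsupport (fun _ : X => (0 : ℝ)) = ∅ := tsupport_eq_empty_iff.2 rfl
      simp [this]
    · exact Lp.coeFn_zero ℝ 2 m
    · have : (⟨0, E.domain.zero_mem⟩ : E.domain) - 0 = 0 := by ext1; simp
      rw [this]
      simpa [NonnegForm.normSq] using hε
  add_mem' := by
    rintro u v ⟨hu, hu'⟩ ⟨hv, hv'⟩
    refine ⟨E.domain.add_mem hu hv, fun ε hε => ?_⟩
    obtain ⟨w, ⟨f, f1, f2, f3, f4⟩, hw⟩ := hu' (ε / 4) (by positivity)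
    obtain ⟨z, ⟨g, g1, g2, g3, g4⟩, hz⟩ := hv' (ε / 4) (by positivity)
    refine ⟨w + z, ⟨f + g, f1.add g1, f2.add g2, ?_, ?_⟩, ?_⟩
    · exact (tsupport_add f g).trans (Set.union_subset f3 g3)
    · exact (Lp.coeFn_add _ _).trans (f4.add g4)
    · have h := E.normSq_add_le (⟨u, hu⟩ - w) (⟨v, hv⟩ - z)
      have e : (⟨u + v, E.domain.add_mem hu hv⟩ : E.domain) - (w + z) =
          (⟨u, hu⟩ - w) + (⟨v, hv⟩ - z) := by
        ext1
        simp only [Submodule.coe_add, Submodule.coe_sub]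
        abel
      rw [e]
      linarith
  smul_mem' := by
    rintro c u ⟨hu, hu'⟩
    refine ⟨E.domain.smul_mem c hu, fun ε hε => ?_⟩
    obtain ⟨w, ⟨f, f1, f2, f3, f4⟩, hw⟩ := hu' (ε / (c ^ 2 + 1)) (by positivity)
    refine ⟨c • w, ⟨c • f, f1.const_smul c, ?_, ?_, ?_⟩, ?_⟩
    · exact f2.mono' ((Function.support_const_smul_subset c f).trans (subset_tsupport f))
    · exact (closure_mono (Function.support_const_smul_subset c f)).trans f3
    · exact (Lp.coeFn_smul c _).trans (f4.const_smul c)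
    · have e : (⟨c • u, E.domain.smul_mem c hu⟩ : E.domain) - c • w =
          c • ((⟨u, hu⟩ : E.domain) - w) := by
        rw [smul_sub]
        rfl
      rw [e, E.normSq_smul]
      have h0 : 0 ≤ E.normSq (⟨u, hu⟩ - w) := add_nonneg (E.nonneg _) (sq_nonneg _)
      rw [lt_div_iff₀ (by positivity)] at hw
      nlinarith

/-- The part of the form on the set `G`, i.e. the form with Dirichlet conditions on `Gᶜ`. -/
def partForm (E : NonnegForm (Lp ℝ 2 m)) (G : Set X) : NonnegForm (Lp ℝ 2 m) :=
  E.restrictTo (partDomain E G) fun _ h => h.1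

end DirichletForms

/-! Multiplication by a nonnegative potential and Schrödinger forms. -/

section Potentials

variable {X : Type*} [MeasurableSpace X] {m : Measure X}

theorem integrable_potential_mul {V : X → ℝ≥0} (hV : Measurable V) {f g : X → ℝ}
    (hf : AEStronglyMeasurable f m) (hg : AEStronglyMeasurable g m)
    (h1 : Integrable (fun x => (V x : ℝ) * f x ^ 2) m)
    (h2 : Integrable (fun x => (V x : ℝ) * g x ^ 2) m) :
    Integrable (fun x => (V x : ℝ) * (f x * g x)) m := by
  refine (h1.add h2).mono' ?_ (Eventually.of_forall fun x => ?_)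
  · exact hV.coe_nnreal_real.aestronglyMeasurable.mul (hf.mul hg)
  · simp only [Real.norm_eq_abs, abs_mul, NNReal.abs_eq, Pi.add_apply]
    rw [← sq_abs (f x), ← sq_abs (g x), ← mul_add]
    refine mul_le_mul_of_nonneg_left ?_ (V x).2
    nlinarith [sq_nonneg (|f x| - |g x|), sq_nonneg |f x|, sq_nonneg |g x|]

/-- The space `{u ∈ L² : ∫ V u² dm < ∞}`. -/
def potentialDomain (m : Measure X) (V : X → ℝ≥0) (hV : Measurable V) :
    Submodule ℝ (Lp ℝ 2 m) where
  carrier := {u | Integrable (fun x => (V x : ℝ) * u x ^ 2) m}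
  zero_mem' := by
    refine (integrable_zero X ℝ m).congr ?_
    filter_upwards [Lp.coeFn_zero ℝ 2 m] with x hx
    rw [hx]
    simp
  add_mem' := by
    intro u v hu hv
    have h := integrable_potential_mul hV (Lp.aestronglyMeasurable u)
      (Lp.aestronglyMeasurable v) hu hv
    refine ((hu.add (h.const_mul 2)).add hv).congr ?_
    filter_upwards [Lp.coeFn_add u v] with x hx
    simp only [hx, Pi.add_apply]
    ring
  smul_mem' := by
    intro c u hu
    refine (hu.const_mul (c ^ 2)).congr ?_
    filter_upwards [Lp.coeFn_smul c u] with x hx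
    simp only [hx, Pi.smul_apply, smul_eq_mul]
    ring

theorem potential_integrable {V : X → ℝ≥0} (hV : Measurable V) (u v : potentialDomain m V hV) :
    Integrable (fun x => (V x : ℝ) * ((u : Lp ℝ 2 m) x * (v : Lp ℝ 2 m) x)) m :=
  integrable_potential_mul hV (Lp.aestronglyMeasurable _) (Lp.aestronglyMeasurable _) u.2 v.2

/-- The form `(u, v) ↦ ∫ V u v dm` of the multiplication operator by `V`. -/
def potentialForm (m : Measure X) (V : X → ℝ≥0) (hV : Measurable V) :
    NonnegForm (Lp ℝ 2 m) where
  domain := potentialDomain m V hV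
  form := LinearMap.mk₂ ℝ
    (fun u v => ∫ x, (V x : ℝ) * ((u : Lp ℝ 2 m) x * (v : Lp ℝ 2 m) x) ∂m)
    (by
      intro u u' v
      rw [← integral_add (potential_integrable hV u v) (potential_integrable hV u' v)]
      refine integral_congr_ae ?_
      filter_upwards [Lp.coeFn_add (u : Lp ℝ 2 m) u'] with x hx
      simp only [Submodule.coe_add, hx, Pi.add_apply]
      ring)
    (by
      intro c u v
      rw [smul_eq_mul, ← integral_const_mul]
      refine integral_congr_ae ?_
      filter_upwards [Lp.coeFn_smul c (u : Lp ℝ 2 m)] with x hx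
      simp only [Submodule.coe_smul, hx, Pi.smul_apply, smul_eq_mul]
      ring)
    (by
      intro u v v'
      rw [← integral_add (potential_integrable hV u v) (potential_integrable hV u v')]
      refine integral_congr_ae ?_
      filter_upwards [Lp.coeFn_add (v : Lp ℝ 2 m) v'] with x hx
      simp only [Submodule.coe_add, hx, Pi.add_apply]
      ring)
    (by
      intro c u v
      rw [smul_eq_mul, ← integral_const_mul]
      refine integral_congr_ae ?_
      filter_upwards [Lp.coeFn_smul c (v : Lp ℝ 2 m)] with x hx
      simp only [Submodule.coe_smul, hx, Pi.smul_apply, smul_eq_mul]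
      ring)
  symm u v := by
    simp only [LinearMap.mk₂_apply, mul_comm]
  nonneg u := by
    simp only [LinearMap.mk₂_apply]
    exact integral_nonneg fun x => mul_nonneg (V x).2 (mul_self_nonneg _)

/-- The Schrödinger operator `-Δ + V`, as a sum of quadratic forms. -/
def schrodingerForm (E : NonnegForm (Lp ℝ 2 m)) (V : X → ℝ≥0) (hV : Measurable V) :
    NonnegForm (Lp ℝ 2 m) :=
  E.add (potentialForm m V hV)

/-- The distribution function `F(V, l) = m {V ≤ l}`. -/
def distFn (m : Measure X) (V : X → ℝ≥0) (l : ℝ) : ℝ≥0∞ := m {x | (V x : ℝ) ≤ l}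

end Potentials

/-! Cellular decompositions. -/

/-- A decomposition of `X` into isometric copies `φ α '' K` of `K` that meet only along the images
of the boundary `bK` of `K`. -/
structure CellularDecomposition {K : Type*} [MetricSpace K] (bK : Set K)
    (X : Type*) [MetricSpace X] (ι : Type*) where
  φ : ι → K → X
  isometry : ∀ α, Isometry (φ α)
  cover : ⋃ α, Set.range (φ α) = Set.univ
  adjoin : ∀ α β, α ≠ β →
    Set.range (φ α) ∩ Set.range (φ β) = (φ α '' bK) ∩ (φ β '' bK)

namespace CellularDecomposition

variable {K : Type*} [MetricSpace K] [MeasurableSpace K] [BorelSpace K] {bK : Set K}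
  {X : Type*} [MetricSpace X] [MeasurableSpace X] [BorelSpace X] {ι : Type*}

/-- The glued measure `μ_∞ = ∑ α, μ ∘ φ_α⁻¹`. -/
def gluedMeasure (D : CellularDecomposition bK X ι) (μ : Measure K) : Measure X :=
  Measure.sum fun α => μ.map (D.φ α)

theorem memLp_comp (D : CellularDecomposition bK X ι) (μ : Measure K) (α : ι)
    (u : Lp ℝ 2 (D.gluedMeasure μ)) : MemLp (fun y => u (D.φ α y)) 2 μ :=
  ((Lp.memLp u).mono_measure (Measure.le_sum (fun α => μ.map (D.φ α)) α)).comp_of_map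
    (D.isometry α).continuous.measurable.aemeasurable

/-- The restriction of `u ∈ L²(X, μ_∞)` to the cell `α`, read on `K`: the class of `u ∘ φ_α`. -/
def restrict (D : CellularDecomposition bK X ι) (μ : Measure K) (α : ι)
    (u : Lp ℝ 2 (D.gluedMeasure μ)) : Lp ℝ 2 μ :=
  (D.memLp_comp μ α u).toLp _

/-- The Laplacian form `E` on `L²(X, μ_∞)` is a form glued from copies of the cell form `EK`
(the form with Neumann conditions): a function of finite energy restricts to functions of finite
energy on the cells and its energy is the sum of the energies on the cells; and a function of the
cell form that satisfies Dirichlet conditions on `bK`, put on one cell and extended by zero, is in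
the domain of `E`. -/
structure IsGluedForm (D : CellularDecomposition bK X ι) (μ : Measure K)
    (EK : NonnegForm (Lp ℝ 2 μ)) (E : NonnegForm (Lp ℝ 2 (D.gluedMeasure μ))) : Prop where
  restrict_mem : ∀ u ∈ E.domain, ∀ α, D.restrict μ α u ∈ EK.domain
  energy : ∀ u v : E.domain, HasSum
    (fun α => EK.form ⟨D.restrict μ α u, restrict_mem u u.2 α⟩
      ⟨D.restrict μ α v, restrict_mem v v.2 α⟩) (E.form u v)
  extend_mem : ∀ (u : Lp ℝ 2 (D.gluedMeasure μ)) (α : ι),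
    D.restrict μ α u ∈ (partForm EK bKᶜ).domain → (∀ β, β ≠ α → D.restrict μ β u = 0) →
    u ∈ E.domain

/-- The piecewise constant majorant `V^∧`, equal to `sup V` over the cell on each open cell; where
several cells meet, the largest of their values is taken. -/
def upper (D : CellularDecomposition bK X ι) (V : X → ℝ≥0) (x : X) : ℝ≥0 :=
  ⨆ α : {α : ι // x ∈ Set.range (D.φ α)}, ⨆ y : K, V (D.φ α y)

/-- The piecewise constant minorant `V^∨`, equal to `inf V` over the cell on each open cell; where
several cells meet, the smallest of their values is taken. -/
def lower (D : CellularDecomposition bK X ι) (V : X → ℝ≥0) (x : X) : ℝ≥0 :=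
  ⨅ α : {α : ι // x ∈ Set.range (D.φ α)}, ⨅ y : K, V (D.φ α y)

end CellularDecomposition

/-- Two-sided comparability at infinity:
`0 < liminf f / g ≤ limsup f / g < ∞` as `l → ∞`. -/
def Comparable (f g : ℝ → ℝ≥0∞) : Prop :=
  0 < liminf (fun l => f l / g l) atTop ∧ limsup (fun l => f l / g l) atTop < ⊤

end

/-! # Weyl asymptotics for Schrödinger operators on glued spaces

The proof is Dirichlet-Neumann bracketing on the cells. Restricting a function of the form domain
of `-Δ + V` to the cells, the energy is the sum of the Neumann energies of the cells plus
`∫ V u²`. On the finitely many cells with `inf V ≤ l`, impose orthogonality to the Neumann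
eigenfunctions up to `l`; then the energy exceeds `l ‖u‖²` (`lt_schrodingerForm`). So the number of
these cells times the Neumann counting function bounds the counting function of `-Δ + V` from above
(`count_schrodingerForm_le`). In the other direction, Dirichlet eigenfunctions up to `l` on the cells
with `sup V ≤ l`, extended by zero, span a space on which the energy is at most `2 l ‖u‖²`
(`le_count_schrodingerForm`). Both numbers of cells are values of the distribution functions of the
piecewise constant potentials `V^∨` and `V^∧`, because `∂K` is a null set, and the doubling
condition compares them with that of `V` (`comparable_of_bracketing`).

The first bound also gives the compact resolvent: since for every `l` the form is at least `l ‖u‖²`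
orthogonally to a space of finite dimension, the embedding of the form domain into `L²` is a norm limit of
operators of finite rank (`NonnegForm.compactResolvent_of_forall_finiteDimensional`). The form is
closed by Fatou's lemma, and densely defined because `-Δ` is regular and `V` is bounded on compact
sets.

Counting functions are compared by two halves of the min-max principle, which rest on the
description of the spectral subspace spanned by the eigenvectors up to `l`: on it the form is at
most `l ‖u‖²`, and on its orthogonal complement the form exceeds `l ‖u‖²`
(`NonnegForm.form_le_of_mem_lowSpace`, `NonnegForm.lt_form_of_mem_orthogonal`).
-/

noncomputable section

/-! ### Spectral subspaces and the min-max principle -/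

namespace NonnegForm

section Eigen

variable {H : Type*} [NormedAddCommGroup H] [InnerProductSpace ℝ H]

theorem OpEq.mem {E : NonnegForm H} {u f : H} (h : E.OpEq u f) : u ∈ E.domain := h.1

theorem OpEq.form_eq {E : NonnegForm H} {u f : H} (h : E.OpEq u f) (hu : u ∈ E.domain)
    (v : E.domain) : E.form ⟨u, hu⟩ v = inner ℝ f (v : H) := h.2 v

theorem OpEq.form_add_inner {E : NonnegForm H} {u f : H} (h : E.OpEq u (f - u)) (v : E.domain) :
    E.form ⟨u, h.mem⟩ v + inner ℝ u (v : H) = inner ℝ f (v : H) := by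
  rw [h.form_eq h.mem v, inner_sub_left]
  ring

/-- The eigenspace of the represented operator for the eigenvalue `k`. -/
def eigenspace (E : NonnegForm H) (k : ℝ) : Submodule ℝ H where
  carrier := {u | E.OpEq u (k • u)}
  zero_mem' := ⟨E.domain.zero_mem, fun v => by
    have : (⟨0, E.domain.zero_mem⟩ : E.domain) = 0 := rfl
    rw [this]
    simp⟩
  add_mem' := by
    rintro u v ⟨hu, hu'⟩ ⟨hv, hv'⟩
    refine ⟨E.domain.add_mem hu hv, fun w => ?_⟩
    have : (⟨u + v, E.domain.add_mem hu hv⟩ : E.domain) = ⟨u, hu⟩ + ⟨v, hv⟩ := rfl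
    rw [this, map_add, LinearMap.add_apply, hu', hv', smul_add, inner_add_left]
  smul_mem' := by
    rintro c u ⟨hu, hu'⟩
    refine ⟨E.domain.smul_mem c hu, fun w => ?_⟩
    have : (⟨c • u, E.domain.smul_mem c hu⟩ : E.domain) = c • ⟨u, hu⟩ := rfl
    rw [this, map_smul, LinearMap.smul_apply, hu', smul_comm k c u, real_inner_smul_left _ _ c,
      smul_eq_mul]

/-- The spectral subspace of the eigenvalues up to `l`, whose dimension is `E.count l`. -/
def lowSpace (E : NonnegForm H) (l : ℝ) : Submodule ℝ H :=
  Submodule.span ℝ {u : H | ∃ k ≤ l, E.OpEq u (k • u)}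

theorem count_eq (E : NonnegForm H) (l : ℝ) :
    E.count l = ((Cardinal.toENat (Module.rank ℝ (E.lowSpace l)) : ℕ∞) : ℝ≥0∞) := rfl

theorem lowSpace_mono (E : NonnegForm H) {l l' : ℝ} (h : l ≤ l') :
    E.lowSpace l ≤ E.lowSpace l' :=
  Submodule.span_mono fun _ ⟨k, hk, hu⟩ => ⟨k, hk.trans h, hu⟩

theorem count_mono (E : NonnegForm H) : Monotone E.count := by
  intro l l' h
  rw [count_eq, count_eq]
  gcongr
  exact Submodule.rank_mono (E.lowSpace_mono h)

theorem finiteDimensional_lowSpace (E : NonnegForm H) {l : ℝ} (h : E.count l ≠ ⊤) :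
    FiniteDimensional ℝ (E.lowSpace l) := by
  rw [count_eq] at h
  have h1 : Cardinal.toENat (Module.rank ℝ (E.lowSpace l)) ≠ ⊤ := by
    simpa using h
  refine Module.rank_lt_aleph0_iff.1 ?_
  exact not_le.1 fun h' => h1 (Cardinal.toENat_eq_top.2 h')

theorem inner_eq_zero_of_eigenspace_ne (E : NonnegForm H) {k k' : ℝ} (hk : k ≠ k') {u v : H}
    (hu : u ∈ E.eigenspace k) (hv : v ∈ E.eigenspace k') : inner ℝ u v = 0 := by
  obtain ⟨hu, hu'⟩ := hu
  obtain ⟨hv, hv'⟩ := hv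
  have h := (hu' ⟨v, hv⟩).symm.trans ((E.symm _ _).trans (hv' ⟨u, hu⟩))
  rw [real_inner_smul_left, real_inner_smul_left, real_inner_comm u v] at h
  have : (k - k') * inner ℝ u v = 0 := by rw [sub_mul, h, sub_self]
  exact (mul_eq_zero.1 this).resolve_left (sub_ne_zero.2 hk)

/-- On the spectral subspace up to `l` the form is at most `l ‖u‖²`. -/
theorem form_le_of_mem_lowSpace (E : NonnegForm H) {l : ℝ} {u : H} (h : u ∈ E.lowSpace l) :
    ∃ hu : u ∈ E.domain, E.form ⟨u, hu⟩ ⟨u, hu⟩ ≤ l * ‖u‖ ^ 2 := by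
  classical
  -- decompose `u` into eigenvectors of distinct eigenvalues, which are orthogonal
  have h1 : E.lowSpace l ≤ ⨆ k : Set.Iic l, E.eigenspace k :=
    Submodule.span_le.2 fun v ⟨k, hk, hv⟩ =>
      (le_iSup (fun k : Set.Iic l => E.eigenspace k) ⟨k, hk⟩) hv
  obtain ⟨f, hf⟩ := (Submodule.mem_iSup_iff_exists_dfinsupp' _ u).1 (h1 h)
  have hmem : ∀ k : Set.Iic l, (f k : H) ∈ E.domain := fun k => (f k).2.1
  have hsum : ((∑ k ∈ f.support, ⟨f k, hmem k⟩ : E.domain) : H) = u := by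
    rw [← hf, DFinsupp.sum]
    simp
  have hu : u ∈ E.domain := by
    rw [← hsum]
    exact SetLike.coe_mem _
  refine ⟨hu, ?_⟩
  have hsum' : (⟨u, hu⟩ : E.domain) = ∑ k ∈ f.support, ⟨f k, hmem k⟩ := Subtype.ext hsum.symm
  have hu2 : u = ∑ k ∈ f.support, (f k : H) := by
    rw [← hf, DFinsupp.sum]
  have key : ∀ k ∈ f.support, inner ℝ (f k : H) u = ‖(f k : H)‖ ^ 2 := by
    intro k hk
    rw [hu2, inner_sum, Finset.sum_eq_single k, real_inner_self_eq_norm_sq]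
    · intro j _ hj
      exact E.inner_eq_zero_of_eigenspace_ne (fun hkj => hj (Subtype.ext hkj.symm)) (f k).2 (f j).2
    · exact fun hk' => absurd hk hk'
  have e1 : E.form ⟨u, hu⟩ ⟨u, hu⟩ = ∑ k ∈ f.support, (k : ℝ) * ‖(f k : H)‖ ^ 2 := by
    nth_rewrite 1 [hsum']
    rw [map_sum, LinearMap.sum_apply]
    refine Finset.sum_congr rfl fun k hk => ?_
    rw [(f k).2.2, real_inner_smul_left, key k hk]
  have e2 : ‖u‖ ^ 2 = ∑ k ∈ f.support, ‖(f k : H)‖ ^ 2 := by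
    rw [← real_inner_self_eq_norm_sq]
    nth_rewrite 1 [hu2]
    rw [sum_inner]
    exact Finset.sum_congr rfl key
  rw [e1, e2, Finset.mul_sum]
  exact Finset.sum_le_sum fun k _ => mul_le_mul_of_nonneg_right k.2 (sq_nonneg _)

theorem mem_lowSpace_of_opEq (E : NonnegForm H) {k l : ℝ} (hk : k ≤ l) {u : H}
    (h : E.OpEq u (k • u)) : u ∈ E.lowSpace l :=
  Submodule.subset_span ⟨k, hk, h⟩

end Eigen

section Resolvent

variable {H : Type*} [NormedAddCommGroup H] [InnerProductSpace ℝ H]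

theorem form_cauchySchwarz (E : NonnegForm H) (u v : E.domain) :
    (E.form u v + inner ℝ (u : H) v) ^ 2 ≤ E.normSq u * E.normSq v := by
  have h : ∀ t : ℝ, 0 ≤ E.normSq u * (t * t) + (2 * (E.form u v + inner ℝ (u : H) v)) * t +
      E.normSq v := by
    intro t
    have h1 : 0 ≤ E.normSq (t • u + v) := add_nonneg (E.nonneg _) (sq_nonneg _)
    have h2 : E.normSq (t • u + v) = E.normSq u * (t * t) +
        (2 * (E.form u v + inner ℝ (u : H) v)) * t + E.normSq v := by
      simp only [normSq, map_add, map_smul, LinearMap.add_apply, LinearMap.smul_apply,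
        smul_eq_mul, Submodule.coe_add, Submodule.coe_smul, E.symm v u]
      rw [norm_add_sq_real, norm_smul, real_inner_smul_left, mul_pow, Real.norm_eq_abs, sq_abs]
      ring
    linarith
  have := discrim_le_zero h
  rw [discrim] at this
  linarith

/-- A nonzero compact symmetric nonnegative operator has its norm as an eigenvalue. -/
theorem _root_.ContinuousLinearMap.exists_eigenvector_norm [CompleteSpace H] {T : H →L[ℝ] H}
    (hT : IsCompactOperator T) (hs : T.IsSymmetric) (h0 : ∀ u, 0 ≤ inner ℝ (T u) u) (hne : T ≠ 0) :
    ∃ w, w ≠ 0 ∧ T w = ‖T‖ • w := by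
  have hnt : Nontrivial H := by
    by_contra h
    rw [not_nontrivial_iff_subsingleton] at h
    exact hne (by ext u; exact Subsingleton.elim _ _)
  have hnorm : ‖T‖ ≠ 0 := norm_ne_zero_iff.2 hne
  have hspec : ‖T‖ ∈ spectrum ℝ (T : H →L[ℝ] H) := by
    intro hres
    obtain ⟨ε, hε, h⟩ := T.rayleighQuotient_le_of_norm_mem_resolventSet (𝕜 := ℝ) hres
    have h1 : ‖T‖ ≤ ‖T‖ - ε := by
      nth_rewrite 1 [T.norm_eq_iSup_rayleighQuotient hs]
      refine ciSup_le fun x => ?_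
      rw [abs_of_nonneg]
      · exact h x
      · rw [ContinuousLinearMap.rayleighQuotient, ContinuousLinearMap.reApplyInnerSelf_apply]
        exact div_nonneg (h0 x) (sq_nonneg _)
    linarith
  obtain ⟨w, hw⟩ := ((hT.hasEigenvalue_iff_mem_spectrum hnorm).2 hspec).exists_hasEigenvector
  exact ⟨w, hw.2, hw.apply_eq_smul⟩

/-- Orthogonally to the spectral subspace up to `l` the form exceeds `l ‖u‖²`. The resolvent `G`
maps that complement to itself, and its norm `κ` there is an eigenvalue. So `κ⁻¹ - 1` is an
eigenvalue of the operator, and it exceeds `l`, as its eigenvector is orthogonal to those up to `l`.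
Finally `‖u‖² = E₁(G u, u) ≤ ⟨G u, u⟩^{1/2} E₁(u)^{1/2} ≤ κ^{1/2} ‖u‖ E₁(u)^{1/2}`. -/
theorem lt_form_of_mem_orthogonal [CompleteSpace H] (E : NonnegForm H) (hE : E.CompactResolvent)
    {l : ℝ} (u : E.domain) (hu : (u : H) ∈ (E.lowSpace l)ᗮ) (hu0 : (u : H) ≠ 0) :
    l * ‖(u : H)‖ ^ 2 < E.form u u := by
  obtain ⟨G, hGc, hG⟩ := hE
  set M := (E.lowSpace l)ᗮ with hM
  have hGf : ∀ f, ∀ v : E.domain,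
      E.form ⟨G f, (hG f).mem⟩ v + inner ℝ (G f) (v : H) = inner ℝ f (v : H) :=
    fun f v => (hG f).form_add_inner v
  have hsymm : G.IsSymmetric := by
    intro f g
    have h1 := hGf f ⟨G g, (hG g).mem⟩
    have h2 := hGf g ⟨G f, (hG f).mem⟩
    rw [E.symm, real_inner_comm (G f) (G g)] at h2
    change inner ℝ (G f) g = inner ℝ f (G g)
    rw [real_inner_comm g (G f)]
    exact h2.symm.trans h1
  have hpos : ∀ f, inner ℝ (G f) f = E.normSq ⟨G f, (hG f).mem⟩ := by
    intro f
    rw [real_inner_comm, ← hGf f ⟨G f, (hG f).mem⟩, normSq, real_inner_self_eq_norm_sq]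
  have hinv : ∀ w ∈ M, G w ∈ M := by
    intro w hw
    refine (Submodule.mem_orthogonal _ _).2 fun t ht => ?_
    refine Submodule.span_induction ?_ (inner_zero_left _) (fun a b _ _ ha hb => ?_)
      (fun c a _ ha => ?_) ht
    rotate_left
    · rw [inner_add_left, ha, hb, add_zero]
    · rw [real_inner_smul_left, ha, mul_zero]
    rintro s ⟨k, hk, hs⟩
    -- `(k + 1) ⟨s, G w⟩ = E₁(s, G w) = ⟨s, w⟩ = 0` for an eigenvector `s`, where `0 ≤ k`
    by_cases hs0 : s = 0
    · simp [hs0]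
    have h1 := hs.form_eq hs.mem ⟨G w, (hG w).mem⟩
    have h2 := hGf w ⟨s, hs.mem⟩
    have h3 : inner ℝ w s = 0 :=
      Submodule.inner_left_of_mem_orthogonal (E.mem_lowSpace_of_opEq hk hs) hw
    have h4 := hs.form_eq hs.mem ⟨s, hs.mem⟩
    have h5 := E.nonneg ⟨s, hs.mem⟩
    rw [h4, real_inner_smul_left, real_inner_self_eq_norm_sq] at h5
    have hk0 : 0 ≤ k := nonneg_of_mul_nonneg_left h5 (by positivity)
    rw [E.symm, h1, h3, real_inner_smul_left, real_inner_comm s (G w)] at h2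
    have h6 : (k + 1) * inner ℝ s (G w) = 0 := by linarith
    exact (mul_eq_zero.1 h6).resolve_left (by positivity)
  let T : M →L[ℝ] M := G.restrict hinv
  have hTc : IsCompactOperator T := hGc.restrict' hinv
  have hTs : T.IsSymmetric := hsymm.restrict_invariant hinv
  have hTpos : ∀ w : M, 0 ≤ inner ℝ (T w) w := by
    intro w
    change 0 ≤ inner ℝ (G w) (w : H)
    rw [hpos]
    exact add_nonneg (E.nonneg _) (sq_nonneg _)
  have hinj : ∀ f, f ∈ E.domain → G f = 0 → f = 0 := by
    intro f hf h
    have h1 := hGf f ⟨f, hf⟩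
    have h2 : (⟨G f, (hG f).mem⟩ : E.domain) = 0 := Subtype.ext h
    rw [h2, h, map_zero, LinearMap.zero_apply, inner_zero_left, add_zero,
      real_inner_self_eq_norm_sq] at h1
    exact norm_eq_zero.1 (pow_eq_zero_iff two_ne_zero |>.1 h1.symm)
  have hTne : T ≠ 0 := by
    intro h
    have : T ⟨u, hu⟩ = 0 := by rw [h]; rfl
    exact hu0 (hinj u u.2 (congrArg Subtype.val this))
  obtain ⟨w, hw0, hw⟩ := T.exists_eigenvector_norm hTc hTs hTpos hTne
  have hκ0 : 0 < ‖T‖ := by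
    refine T.opNorm_nonneg.lt_of_ne' fun h => hu0 (hinj u u.2 ?_)
    have h1 := T.le_opNorm ⟨u, hu⟩
    rw [h, zero_mul] at h1
    exact congrArg Subtype.val (norm_le_zero_iff.1 h1)
  set κ := ‖T‖ with hκ
  have hGw : G w = κ • (w : H) := congrArg Subtype.val hw
  -- otherwise `w` would be an eigenvector up to `l`, orthogonal to itself
  have hκl : κ * (1 + l) < 1 := by
    by_contra hcon
    rw [not_lt] at hcon
    have hop : E.OpEq (w : H) ((κ⁻¹ - 1) • (w : H)) := by
      have h1 := hG (w : H)
      rw [hGw] at h1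
      obtain ⟨h2, h3⟩ := h1
      have h4 : (w : H) = κ⁻¹ • (κ • (w : H)) := by rw [smul_smul, inv_mul_cancel₀ hκ0.ne', one_smul]
      have h5 : (w : H) ∈ E.domain := by
        rw [h4]
        exact E.domain.smul_mem _ h2
      refine ⟨h5, fun v => ?_⟩
      have h6 : (⟨w, h5⟩ : E.domain) = κ⁻¹ • ⟨κ • (w : H), h2⟩ := Subtype.ext h4
      rw [h6, map_smul, LinearMap.smul_apply, h3, smul_eq_mul, inner_sub_left,
        real_inner_smul_left, real_inner_smul_left]
      field_simp
    have hkl : κ⁻¹ - 1 ≤ l := by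
      have : κ⁻¹ ≤ 1 + l := by
        rw [inv_le_iff_one_le_mul₀ hκ0]
        linarith
      linarith
    have h7 := Submodule.inner_right_of_mem_orthogonal (E.mem_lowSpace_of_opEq hkl hop) w.2
    exact hw0 (Subtype.ext (inner_self_eq_zero.1 h7))
  have h1 : inner ℝ (G u) (u : H) ≤ κ * ‖(u : H)‖ ^ 2 := by
    have h2 : inner ℝ (T ⟨u, hu⟩) ⟨u, hu⟩ ≤ ‖T ⟨u, hu⟩‖ * ‖(⟨u, hu⟩ : M)‖ := real_inner_le_norm _ _
    have h3 : ‖T ⟨u, hu⟩‖ ≤ κ * ‖(⟨u, hu⟩ : M)‖ := T.le_opNorm _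
    have h4 : inner ℝ (G u) (u : H) = inner ℝ (T ⟨u, hu⟩) ⟨u, hu⟩ := rfl
    have h5 : ‖(⟨u, hu⟩ : M)‖ = ‖(u : H)‖ := rfl
    rw [h4]
    rw [h5] at h2 h3
    nlinarith [norm_nonneg (u : H)]
  have h2 := E.form_cauchySchwarz ⟨G u, (hG u).mem⟩ u
  rw [hGf, ← hpos, real_inner_self_eq_norm_sq] at h2
  have hun : 0 < ‖(u : H)‖ ^ 2 := by positivity
  have hn : 0 ≤ E.normSq u := add_nonneg (E.nonneg _) (sq_nonneg _)
  have h3 : ‖(u : H)‖ ^ 2 ≤ κ * E.normSq u := by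
    have h4 : (‖(u : H)‖ ^ 2) ^ 2 ≤ κ * ‖(u : H)‖ ^ 2 * E.normSq u :=
      h2.trans (mul_le_mul_of_nonneg_right h1 hn)
    by_contra hcon
    rw [not_le] at hcon
    nlinarith
  have h5 : (1 + l) * ‖(u : H)‖ ^ 2 < E.normSq u := by
    have h6 : κ * ((1 + l) * ‖(u : H)‖ ^ 2) < κ * E.normSq u := by
      calc κ * ((1 + l) * ‖(u : H)‖ ^ 2) = (κ * (1 + l)) * ‖(u : H)‖ ^ 2 := by ring
        _ < 1 * ‖(u : H)‖ ^ 2 := mul_lt_mul_of_pos_right hκl hun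
        _ ≤ _ := by rw [one_mul]; exact h3
    exact lt_of_mul_lt_mul_left h6 hκ0.le
  rw [normSq] at h5
  linarith

/-- Min-max, lower bound: a subspace of the form domain on which the form is at most `l ‖u‖²` is
not larger than the spectral subspace up to `l`. -/
theorem rank_le_rank_lowSpace [CompleteSpace H] (E : NonnegForm H) (hE : E.CompactResolvent)
    {l : ℝ} [FiniteDimensional ℝ (E.lowSpace l)] (W : Submodule ℝ H)
    (hW : ∀ u ∈ W, ∃ hu : u ∈ E.domain, E.form ⟨u, hu⟩ ⟨u, hu⟩ ≤ l * ‖u‖ ^ 2) :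
    Module.rank ℝ W ≤ Module.rank ℝ (E.lowSpace l) := by
  refine LinearMap.rank_le_of_injective
    ((E.lowSpace l).orthogonalProjectionOnto.toLinearMap ∘ₗ W.subtype) ?_
  rw [← LinearMap.ker_eq_bot, LinearMap.ker_eq_bot']
  intro u h
  have h1 : (u : H) ∈ (E.lowSpace l)ᗮ :=
    Submodule.orthogonalProjectionOnto_eq_zero_iff.1 h
  obtain ⟨hu, hle⟩ := hW u u.2
  by_contra hne
  exact absurd hle (not_le.2 (E.lt_form_of_mem_orthogonal hE ⟨u, hu⟩ h1
    fun h0 => hne (Subtype.ext h0)))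

/-- Min-max, upper bound: if the form exceeds `l ‖u‖²` on the kernel of `T`, the spectral subspace
up to `l` is not larger than the target of `T`. -/
theorem toENat_rank_lowSpace_le (E : NonnegForm H) {l : ℝ} {F : Type*} [AddCommGroup F]
    [Module ℝ F] (T : H →ₗ[ℝ] F)
    (hT : ∀ u : E.domain, T u = 0 → (u : H) ≠ 0 → l * ‖(u : H)‖ ^ 2 < E.form u u) :
    Cardinal.toENat (Module.rank ℝ (E.lowSpace l)) ≤ Cardinal.toENat (Module.rank ℝ F) := by
  have hinj : Function.Injective (T ∘ₗ (E.lowSpace l).subtype) := by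
    rw [← LinearMap.ker_eq_bot, LinearMap.ker_eq_bot']
    intro u h
    obtain ⟨hu, hle⟩ := E.form_le_of_mem_lowSpace u.2
    by_contra hne
    exact absurd hle (not_le.2 (hT ⟨u, hu⟩ h fun h0 => hne (Subtype.ext h0)))
  have h := LinearMap.lift_rank_le_of_injective _ hinj
  have h' : Cardinal.toENat _ ≤ Cardinal.toENat _ := OrderHomClass.mono Cardinal.toENat h
  simpa using h'

end Resolvent

/-! ### The Hilbert space of the form norm and compactness of the resolvent -/

section FormSpace

variable {H : Type*} [NormedAddCommGroup H] [InnerProductSpace ℝ H]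

/-- The form domain, as a type carrying the inner product `E₁(u, v) = E(u, v) + ⟨u, v⟩` instead
of the one induced from `H`. -/
def FormSpace (E : NonnegForm H) : Type _ := E.domain

instance (E : NonnegForm H) : AddCommGroup E.FormSpace := inferInstanceAs (AddCommGroup E.domain)

instance (E : NonnegForm H) : Module ℝ E.FormSpace := inferInstanceAs (Module ℝ E.domain)

/-- The embedding of the form domain into `H`. -/
def formIncl (E : NonnegForm H) : E.FormSpace →ₗ[ℝ] H := E.domain.subtype

/-- The energy on `FormSpace`. -/
def formSpaceForm (E : NonnegForm H) : E.FormSpace →ₗ[ℝ] E.FormSpace →ₗ[ℝ] ℝ := E.form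

/-- The inner product `E₁` on the form domain. -/
@[reducible]
def formSpaceCore (E : NonnegForm H) : InnerProductSpace.Core ℝ E.FormSpace where
  inner u v := E.formSpaceForm u v + inner ℝ (E.formIncl u) (E.formIncl v)
  conj_inner_symm u v := by
    have := E.symm v u
    simp only [conj_trivial]
    rw [real_inner_comm]
    congr 1
  re_inner_nonneg u := add_nonneg (E.nonneg u) real_inner_self_nonneg
  add_left u v w := by
    simp only [map_add, LinearMap.add_apply, inner_add_left]
    ring
  smul_left u v r := by
    simp only [map_smul, LinearMap.smul_apply, real_inner_smul_left, smul_eq_mul, conj_trivial]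
    ring
  definite u h := by
    have h1 : 0 ≤ E.formSpaceForm u u := E.nonneg u
    have h2 : 0 ≤ inner ℝ (E.formIncl u) (E.formIncl u) := real_inner_self_nonneg
    have h3 : inner ℝ (E.formIncl u) (E.formIncl u) = 0 := by linarith
    exact Subtype.ext (inner_self_eq_zero.1 h3)

instance (E : NonnegForm H) : NormedAddCommGroup E.FormSpace :=
  E.formSpaceCore.toNormedAddCommGroup

instance (E : NonnegForm H) : InnerProductSpace ℝ E.FormSpace :=
  InnerProductSpace.ofCore E.formSpaceCore.toCore

theorem formSpace_inner (E : NonnegForm H) (u v : E.FormSpace) :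
    inner ℝ u v = E.formSpaceForm u v + inner ℝ (E.formIncl u) (E.formIncl v) := rfl

theorem formSpace_norm_sq (E : NonnegForm H) (u : E.FormSpace) :
    ‖u‖ ^ 2 = E.formSpaceForm u u + ‖E.formIncl u‖ ^ 2 := by
  rw [← real_inner_self_eq_norm_sq, formSpace_inner, real_inner_self_eq_norm_sq]

theorem norm_formIncl_le (E : NonnegForm H) (u : E.FormSpace) : ‖E.formIncl u‖ ≤ ‖u‖ := by
  refine (sq_le_sq₀ (norm_nonneg _) (norm_nonneg _)).1 ?_
  rw [formSpace_norm_sq]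
  exact le_add_of_nonneg_left (E.nonneg u)

/-- The embedding of the form domain into `H`, as a continuous operator for the form norm. -/
def formEmbedding (E : NonnegForm H) : E.FormSpace →L[ℝ] H :=
  E.formIncl.mkContinuous 1 fun u => by simpa using E.norm_formIncl_le u

theorem completeSpace_formSpace [CompleteSpace H] (E : NonnegForm H) (hE : E.Closed) :
    CompleteSpace E.FormSpace := by
  refine Metric.complete_of_cauchySeq_tendsto fun u hu => ?_
  have h1 : CauchySeq fun n => E.formEmbedding (u n) :=
    hu.map E.formEmbedding.uniformContinuous
  obtain ⟨x, hx⟩ := cauchySeq_tendsto_of_complete h1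
  obtain ⟨y, hy, hlim⟩ := hE u x hx (by
    intro ε hε
    obtain ⟨N, hN⟩ := Metric.cauchySeq_iff.1 hu (Real.sqrt ε) (Real.sqrt_pos.2 hε)
    refine ⟨N, fun m hm n hn => ?_⟩
    have h2 := hN m hm n hn
    rw [dist_eq_norm, Real.lt_sqrt (norm_nonneg _), formSpace_norm_sq] at h2
    exact lt_of_le_of_lt (le_add_of_nonneg_right (sq_nonneg _)) h2)
  let y' : E.FormSpace := y
  refine ⟨y', tendsto_iff_norm_sub_tendsto_zero.2 ?_⟩
  have h3 : Tendsto (fun n => ‖u n - y'‖ ^ 2) atTop (𝓝 0) := by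
    have h4 : Tendsto (fun n => ‖E.formEmbedding (u n) - x‖ ^ 2) atTop (𝓝 0) := by
      have := (tendsto_iff_norm_sub_tendsto_zero.1 hx).pow 2
      simpa using this
    have h5 := hlim.add h4
    rw [add_zero] at h5
    refine h5.congr fun n => ?_
    rw [formSpace_norm_sq, map_sub E.formIncl, ← hy]
    rfl
  have h6 := h3.sqrt
  simpa using h6

/-- Riesz representation gives the resolvent `(A + 1)⁻¹ = j j*`, where `j` is the embedding of the
form domain into `H`; it is compact as soon as `j` is. -/
theorem compactResolvent_of_isCompactOperator [CompleteSpace H] (E : NonnegForm H) (hE : E.Closed)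
    (hj : IsCompactOperator E.formEmbedding) : E.CompactResolvent := by
  have := E.completeSpace_formSpace hE
  refine ⟨E.formEmbedding ∘L E.formEmbedding.adjoint, hj.comp_clm E.formEmbedding.adjoint,
    fun f => ?_⟩
  have hmem : (E.formEmbedding ∘L E.formEmbedding.adjoint) f ∈ E.domain :=
    SetLike.coe_mem (E.formEmbedding.adjoint f : E.domain)
  refine ⟨hmem, fun v => ?_⟩
  let v' : E.FormSpace := v
  have h : inner ℝ (E.formEmbedding.adjoint f) v' = inner ℝ f (E.formEmbedding v') :=
    ContinuousLinearMap.adjoint_inner_left _ _ _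
  rw [formSpace_inner] at h
  rw [inner_sub_left]
  exact eq_sub_of_add_eq h

/-- If for every `l` the form is at least `l ‖u‖²` on the orthogonal complement of some
finite-dimensional space, the embedding of the form domain is a norm limit of operators of finite
rank, so that the resolvent is compact. -/
theorem compactResolvent_of_forall_finiteDimensional [CompleteSpace H] (E : NonnegForm H)
    (hE : E.Closed)
    (h : ∀ l : ℝ, 0 < l → ∃ M : Submodule ℝ H, FiniteDimensional ℝ M ∧
      ∀ u : E.domain, (u : H) ∈ Mᗮ → l * ‖(u : H)‖ ^ 2 ≤ E.form u u) : E.CompactResolvent := by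
  have := E.completeSpace_formSpace hE
  refine E.compactResolvent_of_isCompactOperator hE ?_
  have hcl : IsClosed {f : E.FormSpace →L[ℝ] H | IsCompactOperator f} :=
    isClosed_setOfPred_isCompactOperator
  refine hcl.closure_subset_iff.2 subset_rfl ?_
  refine (Metric.mem_closure_iff (α := E.FormSpace →L[ℝ] H)).2 fun ε hε => ?_
  -- for this `l` the embedding has norm at most `ε / 2` on the orthogonal complement
  obtain ⟨M, hM, hMl⟩ := h ((2 / ε) ^ 2) (by positivity)
  -- `w` is orthogonal to `L` in the form norm iff its image in `H` is orthogonal to `M`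
  let L : Submodule ℝ E.FormSpace := M.map E.formEmbedding.adjoint.toLinearMap
  have : FiniteDimensional ℝ L := inferInstance
  refine ⟨(E.formEmbedding ∘L L.subtypeL) ∘L L.orthogonalProjectionOnto, ?_, ?_⟩
  · have hL : IsCompactOperator L.orthogonalProjectionOnto :=
      isCompactOperator_of_locallyCompactSpace_dom L.orthogonalProjectionOnto
    exact hL.clm_comp (E.formEmbedding ∘L L.subtypeL)
  · change ‖-E.formEmbedding + (E.formEmbedding ∘L L.subtypeL) ∘L L.orthogonalProjectionOnto‖ < ε
    rw [neg_add_eq_sub]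
    refine lt_of_le_of_lt (ContinuousLinearMap.opNorm_le_bound _ (half_pos hε).le fun w => ?_)
      (half_lt_self hε)
    set w' : E.FormSpace := w - L.orthogonalProjectionOnto w with hw'
    have e1 : ((E.formEmbedding ∘L L.subtypeL) ∘L L.orthogonalProjectionOnto - E.formEmbedding) w =
        -E.formEmbedding w' := by
      simp [hw']
    have hperp : w' ∈ Lᗮ := L.sub_starProjection_mem_orthogonal w
    have hn : ‖w'‖ ≤ ‖w‖ := by
      have h2 : w' = Lᗮ.orthogonalProjectionOnto w := by
        rw [hw']
        simp [Submodule.starProjection_orthogonal_val]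
      rw [h2]
      exact Lᗮ.norm_orthogonalProjectionOnto_apply_le w
    have hmem : E.formEmbedding w' ∈ Mᗮ := by
      rw [Submodule.mem_orthogonal]
      intro m hm
      rw [← ContinuousLinearMap.adjoint_inner_left]
      exact Submodule.inner_right_of_mem_orthogonal
        (Submodule.mem_map_of_mem (f := E.formEmbedding.adjoint.toLinearMap) hm) hperp
    have h3 : (2 / ε) ^ 2 * ‖E.formEmbedding w'‖ ^ 2 ≤ E.formSpaceForm w' w' := hMl w' hmem
    have h4 := E.formSpace_norm_sq w'
    rw [e1, norm_neg]
    have h5 : (2 / ε * ‖E.formEmbedding w'‖) ^ 2 ≤ ‖w‖ ^ 2 := by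
      rw [mul_pow]
      calc _ ≤ E.formSpaceForm w' w' := h3
        _ ≤ ‖w'‖ ^ 2 := by rw [h4]; exact le_add_of_nonneg_right (sq_nonneg _)
        _ ≤ ‖w‖ ^ 2 := by gcongr
    have h6 := (sq_le_sq₀ (by positivity) (norm_nonneg _)).1 h5
    rw [div_mul_eq_mul_div, div_le_iff₀ hε] at h6
    linarith

end FormSpace

end NonnegForm

/-! ### Restriction to cells and extension by zero -/

theorem MeasureTheory.Lp.norm_sq_eq_integral_sq {Y : Type*} [MeasurableSpace Y] {m : Measure Y}
    (u : Lp ℝ 2 m) : ‖u‖ ^ 2 = ∫ x, u x ^ 2 ∂m := by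
  rw [← real_inner_self_eq_norm_sq, L2.inner_def]
  refine integral_congr_ae (Eventually.of_forall fun x => ?_)
  simp only [real_inner_self_eq_norm_sq, Real.norm_eq_abs, sq_abs]

/-- A locally bounded function is bounded on compact sets. -/
theorem IsCompact.bddAbove_image_of_locally {Y : Type*} [TopologicalSpace Y] {V : Y → ℝ≥0}
    (hV : ∀ x, ∃ U ∈ 𝓝 x, BddAbove (V '' U)) {s : Set Y} (hs : IsCompact s) :
    BddAbove (V '' s) := by
  refine hs.induction_on (p := fun s => BddAbove (V '' s)) (by simp)
    (fun s t hst ht => ht.mono (Set.image_mono hst)) (fun s t hs ht => ?_) fun x _ => ?_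
  · rw [Set.image_union]
    exact hs.union ht
  · obtain ⟨U, hU, hb⟩ := hV x
    exact ⟨U, mem_nhdsWithin_of_mem_nhds hU, hb⟩

namespace CellularDecomposition

variable {K : Type*} [MetricSpace K] {bK : Set K} {X : Type*} [MetricSpace X] {ι : Type*}

theorem mem_boundary_of_mem_range (D : CellularDecomposition bK X ι) {α β : ι} (h : β ≠ α) {y : K}
    (hy : D.φ α y ∈ Set.range (D.φ β)) : y ∈ bK := by
  have h1 : D.φ α y ∈ Set.range (D.φ β) ∩ Set.range (D.φ α) := ⟨hy, y, rfl⟩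
  rw [D.adjoin β α h] at h1
  obtain ⟨z, hz, hzy⟩ := h1.2
  rwa [← (D.isometry α).injective hzy]

theorem eq_of_mem_range (D : CellularDecomposition bK X ι) {α β : ι} {y : K} (hy : y ∉ bK)
    (h : D.φ α y ∈ Set.range (D.φ β)) : β = α := by
  by_contra hne
  exact hy (D.mem_boundary_of_mem_range hne h)

/-- The supremum of `V` over the cell `α`. -/
def cellSup (D : CellularDecomposition bK X ι) (V : X → ℝ≥0) (α : ι) : ℝ≥0 := ⨆ y, V (D.φ α y)

/-- The infimum of `V` over the cell `α`. -/
def cellInf (D : CellularDecomposition bK X ι) (V : X → ℝ≥0) (α : ι) : ℝ≥0 := ⨅ y, V (D.φ α y)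

theorem cellInf_le (D : CellularDecomposition bK X ι) (V : X → ℝ≥0) (α : ι) (y : K) :
    D.cellInf V α ≤ V (D.φ α y) :=
  ciInf_le (OrderBot.bddBelow _) y

theorem upper_eq (D : CellularDecomposition bK X ι) (V : X → ℝ≥0) (α : ι) {y : K}
    (hy : y ∉ bK) : D.upper V (D.φ α y) = D.cellSup V α := by
  have : Unique {β : ι // D.φ α y ∈ Set.range (D.φ β)} :=
    ⟨⟨α, y, rfl⟩, fun β => Subtype.ext (D.eq_of_mem_range hy β.2)⟩
  rw [upper, ciSup_unique, Subsingleton.elim default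
    (⟨α, y, rfl⟩ : {β : ι // D.φ α y ∈ Set.range (D.φ β)})]
  rfl

theorem lower_eq (D : CellularDecomposition bK X ι) (V : X → ℝ≥0) (α : ι) {y : K}
    (hy : y ∉ bK) : D.lower V (D.φ α y) = D.cellInf V α := by
  have : Unique {β : ι // D.φ α y ∈ Set.range (D.φ β)} :=
    ⟨⟨α, y, rfl⟩, fun β => Subtype.ext (D.eq_of_mem_range hy β.2)⟩
  rw [lower, ciInf_unique, Subsingleton.elim default
    (⟨α, y, rfl⟩ : {β : ι // D.φ α y ∈ Set.range (D.φ β)})]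
  rfl

section Compact

variable [CompactSpace K]

theorem le_cellSup (D : CellularDecomposition bK X ι) {V : X → ℝ≥0}
    (hV : ∀ x, ∃ U ∈ 𝓝 x, BddAbove (V '' U)) (α : ι) (y : K) :
    V (D.φ α y) ≤ D.cellSup V α := by
  refine le_ciSup (f := fun y => V (D.φ α y)) ?_ y
  refine ((isCompact_range (D.isometry α).continuous).bddAbove_image_of_locally hV).mono ?_
  rintro _ ⟨z, rfl⟩
  exact ⟨D.φ α z, ⟨z, rfl⟩, rfl⟩

end Compact

variable [MeasurableSpace K] [BorelSpace K] [MeasurableSpace X] [BorelSpace X]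

theorem coeFn_restrict (D : CellularDecomposition bK X ι) (μ : Measure K) (α : ι)
    (u : Lp ℝ 2 (D.gluedMeasure μ)) : D.restrict μ α u =ᵐ[μ] fun y => u (D.φ α y) :=
  MemLp.coeFn_toLp _

variable [CompactSpace K]

theorem measurableEmbedding (D : CellularDecomposition bK X ι) (α : ι) :
    MeasurableEmbedding (D.φ α) :=
  (D.isometry α).isClosedEmbedding.measurableEmbedding

/-- Since each cell has mass one, a ball meets finitely many cells. -/
theorem finite_cells_meeting_ball (D : CellularDecomposition bK X ι) (μ : Measure K)
    [IsProbabilityMeasure μ] (o : X)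
    (hfin : ∀ r : ℝ, D.gluedMeasure μ (Metric.ball o r) < ⊤) (r : ℝ) :
    {α | ∃ y, D.φ α y ∈ Metric.ball o r}.Finite := by
  -- a cell that meets the ball of radius `r` is contained in the ball of radius `R`
  set R := r + Metric.diam (Set.univ : Set K) with hR
  have h1 : ∑' α, μ.map (D.φ α) (Metric.ball o R) ≠ ⊤ :=
    ((Measure.le_sum_apply _ _).trans_lt (hfin R)).ne
  refine (ENNReal.finite_const_le_of_tsum_ne_top h1 one_ne_zero).subset ?_
  rintro α ⟨y, hy⟩
  have h2 : D.φ α ⁻¹' Metric.ball o R = Set.univ := by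
    refine Set.eq_univ_of_forall fun z => ?_
    have h3 : dist z y ≤ Metric.diam (Set.univ : Set K) :=
      Metric.dist_le_diam_of_mem isCompact_univ.isBounded (Set.mem_univ _) (Set.mem_univ _)
    rw [← (D.isometry α).dist_eq] at h3
    have h4 := dist_triangle (D.φ α z) (D.φ α y) o
    rw [Metric.mem_ball] at hy
    rw [Set.mem_preimage, Metric.mem_ball]
    linarith
  change 1 ≤ μ.map (D.φ α) (Metric.ball o R)
  rw [(D.measurableEmbedding α).map_apply, h2, measure_univ]

theorem countable_cells (D : CellularDecomposition bK X ι) (μ : Measure K)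
    [IsProbabilityMeasure μ] (o : X)
    (hfin : ∀ r : ℝ, D.gluedMeasure μ (Metric.ball o r) < ⊤) : Countable ι := by
  have : Nonempty K := μ.nonempty_of_neZero
  have h : (Set.univ : Set ι) ⊆ ⋃ n : ℕ, {α | ∃ y, D.φ α y ∈ Metric.ball o n} := by
    intro α _
    obtain ⟨y⟩ := this
    obtain ⟨n, hn⟩ := exists_nat_gt (dist (D.φ α y) o)
    exact Set.mem_iUnion.2 ⟨n, y, Metric.mem_ball.2 hn⟩
  refine Set.countable_univ_iff.1 ((Set.countable_iUnion fun n : ℕ => ?_).mono h)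
  exact (D.finite_cells_meeting_ball μ o hfin n).countable

theorem ae_gluedMeasure_iff [Countable ι] (D : CellularDecomposition bK X ι) (μ : Measure K)
    {p : X → Prop} : (∀ᵐ x ∂D.gluedMeasure μ, p x) ↔ ∀ α, ∀ᵐ y ∂μ, p (D.φ α y) := by
  rw [gluedMeasure, Measure.ae_sum_iff]
  exact forall_congr' fun α => (D.measurableEmbedding α).ae_map_iff

theorem hasSum_integral_cells (D : CellularDecomposition bK X ι) (μ : Measure K) {g : X → ℝ}
    (hg : Integrable g (D.gluedMeasure μ)) :
    HasSum (fun α => ∫ y, g (D.φ α y) ∂μ) (∫ x, g x ∂D.gluedMeasure μ) := by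
  have h := hasSum_integral_measure hg
  refine h.congr_fun fun α => ?_
  rw [(D.measurableEmbedding α).integral_map]

theorem integrable_comp_cell (D : CellularDecomposition bK X ι) (μ : Measure K) {g : X → ℝ}
    (hg : Integrable g (D.gluedMeasure μ)) (α : ι) : Integrable (fun y => g (D.φ α y)) μ :=
  (D.measurableEmbedding α).integrable_map_iff.1
    (hg.mono_measure (Measure.le_sum (fun α => μ.map (D.φ α)) α))

theorem hasSum_norm_sq_restrict (D : CellularDecomposition bK X ι) (μ : Measure K)
    (u : Lp ℝ 2 (D.gluedMeasure μ)) :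
    HasSum (fun α => ‖D.restrict μ α u‖ ^ 2) (‖u‖ ^ 2) := by
  have h := D.hasSum_integral_cells μ (Lp.memLp u).integrable_sq
  rw [← Lp.norm_sq_eq_integral_sq] at h
  refine h.congr_fun fun α => ?_
  rw [Lp.norm_sq_eq_integral_sq]
  refine integral_congr_ae ?_
  filter_upwards [D.coeFn_restrict μ α u] with y hy
  rw [hy]

theorem norm_restrict_le (D : CellularDecomposition bK X ι) (μ : Measure K) (α : ι)
    (u : Lp ℝ 2 (D.gluedMeasure μ)) : ‖D.restrict μ α u‖ ≤ ‖u‖ :=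
  (sq_le_sq₀ (norm_nonneg _) (norm_nonneg _)).1
    (le_hasSum (D.hasSum_norm_sq_restrict μ u) α fun _ _ => sq_nonneg _)

theorem ae_comp_of_ae (D : CellularDecomposition bK X ι) (μ : Measure K) {p : X → Prop}
    (h : ∀ᵐ x ∂D.gluedMeasure μ, p x) (α : ι) : ∀ᵐ y ∂μ, p (D.φ α y) :=
  (D.measurableEmbedding α).ae_map_iff.1
    (ae_mono (Measure.le_sum (fun α => μ.map (D.φ α)) α) h)

/-- Restriction to a cell, as a continuous operator. -/
def restrictL (D : CellularDecomposition bK X ι) (μ : Measure K) (α : ι) :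
    Lp ℝ 2 (D.gluedMeasure μ) →L[ℝ] Lp ℝ 2 μ :=
  LinearMap.mkContinuous
    { toFun := D.restrict μ α
      map_add' := fun u v => by
        refine Lp.ext ?_
        filter_upwards [D.coeFn_restrict μ α u, D.coeFn_restrict μ α v,
          D.coeFn_restrict μ α (u + v), Lp.coeFn_add (D.restrict μ α u) (D.restrict μ α v),
          D.ae_comp_of_ae μ (Lp.coeFn_add u v) α] with y h1 h2 h3 h4 h5
        rw [h3, h4, h5, Pi.add_apply, Pi.add_apply, h1, h2]
      map_smul' := fun c u => by
        refine Lp.ext ?_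
        filter_upwards [D.coeFn_restrict μ α u, D.coeFn_restrict μ α (c • u),
          Lp.coeFn_smul c (D.restrict μ α u), D.ae_comp_of_ae μ (Lp.coeFn_smul c u) α]
          with y h1 h2 h3 h4
        simp only [RingHom.id_apply]
        rw [h2, h3, h4, Pi.smul_apply, Pi.smul_apply, h1] }
    1 fun u => by simpa using D.norm_restrict_le μ α u

theorem restrictL_apply (D : CellularDecomposition bK X ι) (μ : Measure K) (α : ι)
    (u : Lp ℝ 2 (D.gluedMeasure μ)) : D.restrictL μ α u = D.restrict μ α u := rfl

theorem eq_zero_of_restrict_eq_zero (D : CellularDecomposition bK X ι) (μ : Measure K)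
    {u : Lp ℝ 2 (D.gluedMeasure μ)} (h : ∀ α, D.restrict μ α u = 0) : u = 0 := by
  have h1 := D.hasSum_norm_sq_restrict μ u
  simp only [h, norm_zero, ne_eq, OfNat.ofNat_ne_zero, not_false_eq_true, zero_pow] at h1
  have h2 := h1.unique hasSum_zero
  exact norm_eq_zero.1 (pow_eq_zero_iff two_ne_zero |>.1 h2)

/-- Extension by zero of a function on one cell. -/
theorem exists_extension [Countable ι] (D : CellularDecomposition bK X ι) (μ : Measure K)
    (hμ : μ bK = 0) (α : ι) (f : Lp ℝ 2 μ) :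
    ∃ u : Lp ℝ 2 (D.gluedMeasure μ), D.restrict μ α u = f ∧
      ∀ β, β ≠ α → D.restrict μ β u = 0 := by
  classical
  set g : X → ℝ := Function.extend (D.φ α) f 0 with hg
  have hgm : Measurable g :=
    (D.measurableEmbedding α).measurable_extend (Lp.stronglyMeasurable f).measurable
      measurable_const
  have hgα : ∀ y, g (D.φ α y) = f y := fun y => (D.isometry α).injective.extend_apply _ _ _
  have hgβ : ∀ β, β ≠ α → ∀ᵐ y ∂μ, g (D.φ β y) = 0 := by
    intro β hβ
    filter_upwards [measure_eq_zero_iff_ae_notMem.1 hμ] with y hy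
    refine Function.extend_apply' _ _ _ fun ⟨z, hz⟩ => hy ?_
    exact D.mem_boundary_of_mem_range hβ.symm ⟨z, hz⟩
  have hmem : MemLp g 2 (D.gluedMeasure μ) := by
    rw [memLp_two_iff_integrable_sq hgm.aestronglyMeasurable, gluedMeasure]
    have hz : ∀ β, β ≠ α → (fun y => g (D.φ β y) ^ 2) =ᵐ[μ] 0 := by
      intro β hβ
      filter_upwards [hgβ β hβ] with y hy
      simp [hy]
    refine integrable_sum_measure (fun β => ?_) (summable_of_ne_finset_zero (s := {α}) ?_)
    · rw [(D.measurableEmbedding β).integrable_map_iff]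
      by_cases hβ : β = α
      · subst hβ
        refine ((Lp.memLp f).integrable_sq).congr (Eventually.of_forall fun y => ?_)
        simp only [Function.comp, hgα]
      · exact (integrable_zero K ℝ μ).congr (hz β hβ).symm
    · intro β hβ
      rw [(D.measurableEmbedding β).integral_map]
      refine integral_eq_zero_of_ae ?_
      filter_upwards [hgβ β (by simpa using hβ)] with y hy
      simp [hy]
  refine ⟨hmem.toLp g, Lp.ext ?_, fun β hβ => Lp.ext ?_⟩
  · filter_upwards [D.coeFn_restrict μ α (hmem.toLp g), D.ae_comp_of_ae μ hmem.coeFn_toLp α]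
      with y h1 h2
    rw [h1, h2, hgα]
  · filter_upwards [D.coeFn_restrict μ β (hmem.toLp g), D.ae_comp_of_ae μ hmem.coeFn_toLp β,
      hgβ β hβ, Lp.coeFn_zero ℝ 2 μ] with y h1 h2 h3 h4
    rw [h1, h2, h3, h4, Pi.zero_apply]

theorem distFn_gluedMeasure [Countable ι] (D : CellularDecomposition bK X ι) (μ : Measure K)
    (W : X → ℝ≥0) (l : ℝ) :
    distFn (D.gluedMeasure μ) W l = ∑' α, μ {y | (W (D.φ α y) : ℝ) ≤ l} := by
  rw [distFn, gluedMeasure, Measure.sum_apply_of_countable]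
  refine tsum_congr fun α => ?_
  rw [(D.measurableEmbedding α).map_apply]
  rfl

/-- The distribution function of a cell-wise constant function counts cells. -/
theorem distFn_eq_encard [Countable ι] (D : CellularDecomposition bK X ι) (μ : Measure K)
    [IsProbabilityMeasure μ] (hμ : μ bK = 0) {W : X → ℝ≥0} {c : ι → ℝ≥0}
    (hW : ∀ α y, y ∉ bK → W (D.φ α y) = c α) (l : ℝ) :
    distFn (D.gluedMeasure μ) W l = ({α | (c α : ℝ) ≤ l}.encard : ℝ≥0∞) := by
  classical
  rw [D.distFn_gluedMeasure, ← ENNReal.tsum_set_one, tsum_subtype _ fun _ => (1 : ℝ≥0∞)]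
  refine tsum_congr fun α => ?_
  have h : ∀ᵐ y ∂μ, W (D.φ α y) = c α := by
    filter_upwards [measure_eq_zero_iff_ae_notMem.1 hμ] with y hy using hW α y hy
  by_cases hα : (c α : ℝ) ≤ l
  · rw [Set.indicator_of_mem (s := {α | (c α : ℝ) ≤ l}) hα]
    have h1 : {y | (W (D.φ α y) : ℝ) ≤ l} =ᵐ[μ] Set.univ := by
      refine eventuallyEq_univ.2 ?_
      filter_upwards [h] with y hy
      rwa [hy]
    rw [measure_congr h1, measure_univ]
  · rw [Set.indicator_of_notMem (s := {α | (c α : ℝ) ≤ l}) hα]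
    refine measure_eq_zero_iff_ae_notMem.2 ?_
    filter_upwards [h] with y hy
    rwa [hy]

theorem distFn_upper [Countable ι] (D : CellularDecomposition bK X ι) (μ : Measure K)
    [IsProbabilityMeasure μ] (hμ : μ bK = 0) (V : X → ℝ≥0) (l : ℝ) :
    distFn (D.gluedMeasure μ) (D.upper V) l = ({α | (D.cellSup V α : ℝ) ≤ l}.encard : ℝ≥0∞) :=
  D.distFn_eq_encard μ hμ (fun α _ hy => D.upper_eq V α hy) l

theorem distFn_lower [Countable ι] (D : CellularDecomposition bK X ι) (μ : Measure K)
    [IsProbabilityMeasure μ] (hμ : μ bK = 0) (V : X → ℝ≥0) (l : ℝ) :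
    distFn (D.gluedMeasure μ) (D.lower V) l = ({α | (D.cellInf V α : ℝ) ≤ l}.encard : ℝ≥0∞) :=
  D.distFn_eq_encard μ hμ (fun α _ hy => D.lower_eq V α hy) l

theorem distFn_le_distFn_lower [Countable ι] (D : CellularDecomposition bK X ι) (μ : Measure K)
    (hμ : μ bK = 0) (V : X → ℝ≥0) (l : ℝ) :
    distFn (D.gluedMeasure μ) V l ≤ distFn (D.gluedMeasure μ) (D.lower V) l := by
  refine measure_mono_ae ((D.ae_gluedMeasure_iff μ).2 fun α => ?_)
  filter_upwards [measure_eq_zero_iff_ae_notMem.1 hμ] with y hy h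
  change (D.lower V (D.φ α y) : ℝ) ≤ l
  rw [D.lower_eq V α hy]
  exact (NNReal.coe_le_coe.2 (D.cellInf_le V α y)).trans h

theorem distFn_upper_le_distFn [Countable ι] (D : CellularDecomposition bK X ι) (μ : Measure K)
    (hμ : μ bK = 0) {V : X → ℝ≥0} (hV : ∀ x, ∃ U ∈ 𝓝 x, BddAbove (V '' U)) (l : ℝ) :
    distFn (D.gluedMeasure μ) (D.upper V) l ≤ distFn (D.gluedMeasure μ) V l := by
  refine measure_mono_ae ((D.ae_gluedMeasure_iff μ).2 fun α => ?_)
  filter_upwards [measure_eq_zero_iff_ae_notMem.1 hμ] with y hy h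
  change (D.upper V (D.φ α y) : ℝ) ≤ l at h
  rw [D.upper_eq V α hy] at h
  exact (NNReal.coe_le_coe.2 (D.le_cellSup hV α y)).trans h

theorem finite_cellInf_le (D : CellularDecomposition bK X ι) (μ : Measure K)
    [IsProbabilityMeasure μ] (o : X) (hfin : ∀ r : ℝ, D.gluedMeasure μ (Metric.ball o r) < ⊤)
    {V : X → ℝ≥0} (hVinf : Tendsto V (comap (fun x => dist o x) atTop) atTop) (l : ℝ) :
    {α | (D.cellInf V α : ℝ) ≤ l}.Finite := by
  have : Nonempty K := μ.nonempty_of_neZero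
  have h1 := hVinf.eventually (eventually_ge_atTop (Real.toNNReal l + 1))
  rw [eventually_comap] at h1
  obtain ⟨r, hr⟩ := eventually_atTop.1 h1
  refine (D.finite_cells_meeting_ball μ o hfin r).subset fun α hα => ?_
  have h2 : D.cellInf V α < Real.toNNReal l + 1 :=
    lt_of_le_of_lt (NNReal.le_toNNReal_of_coe_le hα) (lt_add_one _)
  obtain ⟨y, hy⟩ := exists_lt_of_ciInf_lt h2
  refine ⟨y, ?_⟩
  rw [Metric.mem_ball']
  by_contra hcon
  exact absurd (hr _ (not_lt.1 hcon) _ rfl) (not_le.2 hy)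

theorem finite_cellSup_le (D : CellularDecomposition bK X ι) (μ : Measure K)
    [IsProbabilityMeasure μ] (o : X) (hfin : ∀ r : ℝ, D.gluedMeasure μ (Metric.ball o r) < ⊤)
    {V : X → ℝ≥0} (hV : ∀ x, ∃ U ∈ 𝓝 x, BddAbove (V '' U))
    (hVinf : Tendsto V (comap (fun x => dist o x) atTop) atTop) (l : ℝ) :
    {α | (D.cellSup V α : ℝ) ≤ l}.Finite := by
  obtain ⟨y⟩ : Nonempty K := μ.nonempty_of_neZero
  refine (D.finite_cellInf_le μ o hfin hVinf l).subset fun α hα => ?_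
  exact (NNReal.coe_le_coe.2 ((D.cellInf_le V α y).trans (D.le_cellSup hV α y))).trans hα

end CellularDecomposition

/-! ### Schrödinger forms are closed and densely defined -/

namespace NonnegForm

variable {H : Type*} [NormedAddCommGroup H] [InnerProductSpace ℝ H]

theorem Closed.add {E Q : NonnegForm H} (hE : E.Closed) (hQ : Q.Closed) : (E.add Q).Closed := by
  intro u x hx hu
  let uE : ℕ → E.domain := fun n => ⟨u n, (u n).2.1⟩
  let uQ : ℕ → Q.domain := fun n => ⟨u n, (u n).2.2⟩
  have hsum : ∀ m n, (E.add Q).form (u m - u n) (u m - u n) =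
      E.form (uE m - uE n) (uE m - uE n) + Q.form (uQ m - uQ n) (uQ m - uQ n) :=
    fun m n => rfl
  obtain ⟨y, hy, hy'⟩ := hE uE x hx fun ε hε => by
    obtain ⟨N, hN⟩ := hu ε hε
    refine ⟨N, fun m hm n hn => lt_of_le_of_lt ?_ (hN m hm n hn)⟩
    rw [hsum]
    exact le_add_of_nonneg_right (Q.nonneg _)
  obtain ⟨z, hz, hz'⟩ := hQ uQ x hx fun ε hε => by
    obtain ⟨N, hN⟩ := hu ε hε
    refine ⟨N, fun m hm n hn => lt_of_le_of_lt ?_ (hN m hm n hn)⟩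
    rw [hsum]
    exact le_add_of_nonneg_left (E.nonneg _)
  obtain ⟨y, hyE⟩ := y
  obtain ⟨z, hzQ⟩ := z
  subst hy
  obtain rfl : z = y := hz
  refine ⟨⟨z, hyE, hzQ⟩, rfl, ?_⟩
  have h := hy'.add hz'
  rw [add_zero] at h
  exact h

end NonnegForm

section Potential

variable {X : Type*} [MeasurableSpace X] {m : Measure X}

theorem potentialForm_apply {V : X → ℝ≥0} (hV : Measurable V)
    (u : (potentialForm m V hV).domain) :
    (potentialForm m V hV).form u u = ∫ x, (V x : ℝ) * (u : Lp ℝ 2 m) x ^ 2 ∂m := by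
  change ∫ x, (V x : ℝ) * ((u : Lp ℝ 2 m) x * (u : Lp ℝ 2 m) x) ∂m = _
  simp only [sq]

theorem integrable_of_mem_potentialDomain {V : X → ℝ≥0} {hV : Measurable V} {u : Lp ℝ 2 m}
    (h : u ∈ (potentialForm m V hV).domain) :
    Integrable (fun x => (V x : ℝ) * u x ^ 2) m := h

theorem mem_potentialDomain_of_integrable {V : X → ℝ≥0} (hV : Measurable V) {u : Lp ℝ 2 m}
    (h : Integrable (fun x => (V x : ℝ) * u x ^ 2) m) :
    u ∈ (potentialForm m V hV).domain := h

/-- If `V ≤ c` wherever `u` does not vanish, then `u` is in the domain of the potential. -/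
theorem mem_potentialDomain_of_bound {V : X → ℝ≥0} (hV : Measurable V) {u : Lp ℝ 2 m} {c : ℝ}
    (h : ∀ᵐ x ∂m, (V x : ℝ) * u x ^ 2 ≤ c * u x ^ 2) :
    ∃ hu : u ∈ (potentialForm m V hV).domain,
      (potentialForm m V hV).form ⟨u, hu⟩ ⟨u, hu⟩ ≤ c * ‖u‖ ^ 2 := by
  have h1 : Integrable (fun x => c * u x ^ 2) m := (Lp.memLp u).integrable_sq.const_mul c
  have h2 : Integrable (fun x => (V x : ℝ) * u x ^ 2) m := by
    refine h1.mono' (hV.coe_nnreal_real.aestronglyMeasurable.mul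
      ((Lp.aestronglyMeasurable u).pow 2)) ?_
    filter_upwards [h] with x hx
    have h0 : 0 ≤ (V x : ℝ) * u x ^ 2 := mul_nonneg (V x).2 (sq_nonneg _)
    rwa [Real.norm_of_nonneg h0]
  refine ⟨h2, ?_⟩
  rw [potentialForm_apply, Lp.norm_sq_eq_integral_sq, ← integral_const_mul]
  exact integral_mono_ae h2 h1 h

/-- The quadratic form of a potential is closed: by Fatou's lemma along a subsequence that converges
almost everywhere, `∫ V (u_k - x)²` is at most the bound for `∫ V (u_k - u_j)²` with `j` large. -/
theorem closed_potentialForm {V : X → ℝ≥0} (hV : Measurable V) :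
    (potentialForm m V hV).Closed := by
  intro u x hx hu
  obtain ⟨ns, hns, hae⟩ := (tendstoInMeasure_of_tendsto_Lp hx).exists_seq_tendsto_ae
  have key : ∀ ε > 0, ∃ N, ∀ k ≥ N,
      ∃ hmem : (u k : Lp ℝ 2 m) - x ∈ (potentialForm m V hV).domain,
        (potentialForm m V hV).form ⟨_, hmem⟩ ⟨_, hmem⟩ ≤ ε := by
    intro ε hε
    obtain ⟨N, hN⟩ := hu ε hε
    refine ⟨N, fun k hk => ?_⟩
    set f : ℕ → X → ℝ≥0∞ := fun j y =>
      ENNReal.ofReal ((V y : ℝ) * ((u k : Lp ℝ 2 m) y - (u (ns j) : Lp ℝ 2 m) y) ^ 2) with hf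
    have hmeas : ∀ w : Lp ℝ 2 m, AEStronglyMeasurable
        (fun y => (V y : ℝ) * ((u k : Lp ℝ 2 m) y - w y) ^ 2) m := fun w =>
      hV.coe_nnreal_real.aestronglyMeasurable.mul
        (((Lp.aestronglyMeasurable _).sub (Lp.aestronglyMeasurable w)).pow 2)
    have hpos : ∀ w : Lp ℝ 2 m, ∀ y, 0 ≤ (V y : ℝ) * ((u k : Lp ℝ 2 m) y - w y) ^ 2 :=
      fun w y => mul_nonneg (V y).2 (sq_nonneg _)
    have hdiff : ∀ w : Lp ℝ 2 m, (fun y => (V y : ℝ) * ((u k : Lp ℝ 2 m) - w : Lp ℝ 2 m) y ^ 2)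
        =ᵐ[m] fun y => (V y : ℝ) * ((u k : Lp ℝ 2 m) y - w y) ^ 2 := by
      intro w
      filter_upwards [Lp.coeFn_sub (u k : Lp ℝ 2 m) w] with y hy
      rw [hy, Pi.sub_apply]
    have hbound : ∀ᶠ j in atTop, ∫⁻ y, f j y ∂m ≤ ENNReal.ofReal ε := by
      filter_upwards [hns.tendsto_atTop.eventually_ge_atTop N] with j hj
      have h1 := (hN k hk _ hj).le
      rw [potentialForm_apply] at h1
      have h2 := integrable_of_mem_potentialDomain (u k - u (ns j)).2
      have h3 := hdiff (u (ns j))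
      have h4 := h2.congr h3
      rw [Submodule.coe_sub, integral_congr_ae h3] at h1
      rw [hf, ← ofReal_integral_eq_lintegral_ofReal h4 (Eventually.of_forall (hpos _))]
      exact ENNReal.ofReal_le_ofReal h1
    have hlim : ∫⁻ y, ENNReal.ofReal ((V y : ℝ) * ((u k : Lp ℝ 2 m) y - x y) ^ 2) ∂m ≤
        ENNReal.ofReal ε := by
      calc _ = ∫⁻ y, liminf (fun j => f j y) atTop ∂m := by
            refine lintegral_congr_ae ?_
            filter_upwards [hae] with y hy
            refine (Tendsto.liminf_eq ?_).symm
            exact (ENNReal.continuous_ofReal.tendsto _).comp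
              (((tendsto_const_nhds.sub hy).pow 2).const_mul _)
        _ ≤ liminf (fun j => ∫⁻ y, f j y ∂m) atTop :=
            lintegral_liminf_le' fun j => (hmeas _).aemeasurable.ennreal_ofReal
        _ ≤ liminf (fun _ : ℕ => ENNReal.ofReal ε) atTop := liminf_le_liminf hbound
        _ = ENNReal.ofReal ε := liminf_const _
    have hint : Integrable (fun y => (V y : ℝ) * ((u k : Lp ℝ 2 m) y - x y) ^ 2) m := by
      refine ⟨hmeas x, ?_⟩
      rw [hasFiniteIntegral_iff_ofReal (Eventually.of_forall (hpos x))]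
      exact hlim.trans_lt ENNReal.ofReal_lt_top
    refine ⟨mem_potentialDomain_of_integrable hV (hint.congr (hdiff x).symm), ?_⟩
    rw [potentialForm_apply, integral_congr_ae (hdiff x)]
    rw [← ofReal_integral_eq_lintegral_ofReal hint (Eventually.of_forall (hpos x))] at hlim
    exact (ENNReal.ofReal_le_ofReal_iff hε.le).1 hlim
  obtain ⟨N, hN⟩ := key 1 one_pos
  obtain ⟨h1, -⟩ := hN N le_rfl
  have hxmem : x ∈ (potentialForm m V hV).domain := by
    have h2 := (potentialForm m V hV).domain.sub_mem (u N).2 h1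
    rwa [sub_sub_cancel] at h2
  refine ⟨⟨x, hxmem⟩, rfl, Metric.tendsto_atTop.2 fun ε hε => ?_⟩
  obtain ⟨N, hN⟩ := key (ε / 2) (half_pos hε)
  refine ⟨N, fun k hk => ?_⟩
  obtain ⟨h2, h3⟩ := hN k hk
  rw [Real.dist_eq, sub_zero, abs_of_nonneg ((potentialForm m V hV).nonneg _)]
  exact lt_of_le_of_lt h3 (half_lt_self hε)

end Potential

theorem denselyDefinedClosed_schrodingerForm {X : Type*} [TopologicalSpace X] [MeasurableSpace X]
    {m : Measure X} {E : NonnegForm (Lp ℝ 2 m)} (hE : IsLaplacianForm E) {V : X → ℝ≥0}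
    (hVm : Measurable V) (hVb : ∀ x, ∃ U ∈ 𝓝 x, BddAbove (V '' U)) :
    (schrodingerForm E V hVm).DenselyDefinedClosed := by
  refine ⟨?_, hE.dirichlet.1.2.add (closed_potentialForm hVm)⟩
  rw [Metric.dense_iff]
  intro x r hr
  obtain ⟨v, hv, hvE⟩ := Metric.dense_iff.1 hE.dirichlet.1.1 x (r / 2) (half_pos hr)
  obtain ⟨w, ⟨f, -, hfc, -, hwf⟩, hw⟩ := hE.regular.1 ⟨v, hvE⟩ ((r / 2) ^ 2) (by positivity)
  refine ⟨w, ?_, w.2, ?_⟩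
  · have h1 : ‖v - (w : Lp ℝ 2 m)‖ ^ 2 < (r / 2) ^ 2 :=
      lt_of_le_of_lt (le_add_of_nonneg_left (E.nonneg _)) hw
    have h2 := lt_of_pow_lt_pow_left₀ 2 (half_pos hr).le h1
    rw [Metric.mem_ball, dist_comm] at hv ⊢
    have h3 := dist_triangle x v (w : Lp ℝ 2 m)
    rw [← dist_eq_norm] at h2
    linarith
  · obtain ⟨c, hc⟩ := hfc.bddAbove_image_of_locally hVb
    refine (mem_potentialDomain_of_bound hVm (c := c) ?_).1
    filter_upwards [hwf] with x hx
    by_cases hxs : x ∈ tsupport f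
    · exact mul_le_mul_of_nonneg_right (NNReal.coe_le_coe.2 (hc ⟨x, hxs, rfl⟩)) (sq_nonneg _)
    · rw [hx, image_eq_zero_of_notMem_tsupport hxs]
      simp

/-! ### Bracketing between Neumann and Dirichlet conditions on the cells -/

theorem NonnegForm.count_eq_finrank {H : Type*} [NormedAddCommGroup H] [InnerProductSpace ℝ H]
    (E : NonnegForm H) (l : ℝ) [FiniteDimensional ℝ (E.lowSpace l)] :
    E.count l = (Module.finrank ℝ (E.lowSpace l) : ℝ≥0∞) := by
  rw [E.count_eq, ← Module.finrank_eq_rank, Cardinal.toENat_nat]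
  rfl

/-- A continuous operator with finite-dimensional target vanishes on the orthogonal complement of
a finite-dimensional space. -/
theorem ContinuousLinearMap.exists_finiteDimensional_orthogonal_le_ker {H F : Type*}
    [NormedAddCommGroup H] [InnerProductSpace ℝ H] [CompleteSpace H] [NormedAddCommGroup F]
    [NormedSpace ℝ F] [FiniteDimensional ℝ F] (T : H →L[ℝ] F) :
    ∃ M : Submodule ℝ H, FiniteDimensional ℝ M ∧ ∀ u ∈ Mᗮ, T u = 0 := by
  refine ⟨T.kerᗮ, ?_, fun u hu => ?_⟩
  · refine FiniteDimensional.of_injective (T.toLinearMap ∘ₗ T.kerᗮ.subtype) ?_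
    rw [← LinearMap.ker_eq_bot, LinearMap.ker_eq_bot']
    intro u hu
    have h1 : (u : H) ∈ T.ker := hu
    exact Subtype.ext (inner_self_eq_zero.1 (Submodule.inner_right_of_mem_orthogonal h1 u.2))
  · rw [Submodule.orthogonal_orthogonal_eq_closure,
      IsClosed.submodule_topologicalClosure_eq T.isClosed_ker] at hu
    exact hu

namespace CellularDecomposition

variable {K : Type*} [MetricSpace K] [CompactSpace K] [MeasurableSpace K] [BorelSpace K]
  {bK : Set K} {X : Type*} [MetricSpace X] [MeasurableSpace X] [BorelSpace X] {ι : Type*}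
  {D : CellularDecomposition bK X ι} {μ : Measure K}
  {EK : NonnegForm (Lp ℝ 2 μ)} {E : NonnegForm (Lp ℝ 2 (D.gluedMeasure μ))}

/-- Neumann bracketing: the energy of `u` is the sum of the energies on the cells, which exceed
`l ‖u‖²` on a cell where `V > l`, and also on any other cell if `u` is orthogonal there to the
Neumann eigenfunctions up to `l`. -/
theorem lt_schrodingerForm (hglue : D.IsGluedForm μ EK E) (hresN : EK.CompactResolvent)
    {V : X → ℝ≥0} (hVm : Measurable V) {l : ℝ} (u : (schrodingerForm E V hVm).domain)
    (hu : ∀ α, (D.cellInf V α : ℝ) ≤ l → D.restrict μ α u ∈ (EK.lowSpace l)ᗮ)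
    (hu0 : (u : Lp ℝ 2 (D.gluedMeasure μ)) ≠ 0) :
    l * ‖(u : Lp ℝ 2 (D.gluedMeasure μ))‖ ^ 2 < (schrodingerForm E V hVm).form u u := by
  obtain ⟨u, huE, huV⟩ := u
  have hint := integrable_of_mem_potentialDomain huV
  have hform : (schrodingerForm E V hVm).form ⟨u, huE, huV⟩ ⟨u, huE, huV⟩ =
      E.form ⟨u, huE⟩ ⟨u, huE⟩ + ∫ x, (V x : ℝ) * u x ^ 2 ∂D.gluedMeasure μ := by
    rw [← potentialForm_apply hVm ⟨u, huV⟩]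
    rfl
  have hsum := (hglue.energy ⟨u, huE⟩ ⟨u, huE⟩).add (D.hasSum_integral_cells μ hint)
  rw [← hform] at hsum
  have hnorm := (D.hasSum_norm_sq_restrict μ u).mul_left l
  have hpot : ∀ α, (D.cellInf V α : ℝ) * ‖D.restrict μ α u‖ ^ 2 ≤
      ∫ y, (V (D.φ α y) : ℝ) * u (D.φ α y) ^ 2 ∂μ := by
    intro α
    rw [Lp.norm_sq_eq_integral_sq, ← integral_const_mul]
    refine integral_mono_ae ((Lp.memLp _).integrable_sq.const_mul _)
      (D.integrable_comp_cell μ hint α) ?_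
    filter_upwards [D.coeFn_restrict μ α u] with y hy
    rw [hy]
    exact mul_le_mul_of_nonneg_right (NNReal.coe_le_coe.2 (D.cellInf_le V α y)) (sq_nonneg _)
  have hlt : ∀ α, D.restrict μ α u ≠ 0 → l * ‖D.restrict μ α u‖ ^ 2 <
      EK.form ⟨D.restrict μ α u, hglue.restrict_mem u huE α⟩
        ⟨D.restrict μ α u, hglue.restrict_mem u huE α⟩ +
      ∫ y, (V (D.φ α y) : ℝ) * u (D.φ α y) ^ 2 ∂μ := by
    intro α hα
    have hsq : 0 < ‖D.restrict μ α u‖ ^ 2 := by positivity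
    have h1 := hpot α
    have hc : (0 : ℝ) ≤ D.cellInf V α := (D.cellInf V α).2
    by_cases hl : (D.cellInf V α : ℝ) ≤ l
    · have h2 := EK.lt_form_of_mem_orthogonal hresN
        ⟨D.restrict μ α u, hglue.restrict_mem u huE α⟩ (hu α hl) hα
      have h3 := mul_nonneg hc hsq.le
      simp only at h2
      linarith
    · have h2 := EK.nonneg ⟨D.restrict μ α u, hglue.restrict_mem u huE α⟩
      have h3 := mul_lt_mul_of_pos_right (not_le.1 hl) hsq
      linarith
  have hle : ∀ α, l * ‖D.restrict μ α u‖ ^ 2 ≤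
      EK.form ⟨D.restrict μ α u, hglue.restrict_mem u huE α⟩
        ⟨D.restrict μ α u, hglue.restrict_mem u huE α⟩ +
      ∫ y, (V (D.φ α y) : ℝ) * u (D.φ α y) ^ 2 ∂μ := by
    intro α
    by_cases hα : D.restrict μ α u = 0
    · have h1 := hpot α
      have h2 := EK.nonneg ⟨D.restrict μ α u, hglue.restrict_mem u huE α⟩
      have h3 : ‖D.restrict μ α u‖ ^ 2 = 0 := by rw [hα, norm_zero, zero_pow two_ne_zero]
      rw [h3, mul_zero] at h1 ⊢
      exact add_nonneg h2 h1
    · exact (hlt α hα).le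
  obtain ⟨α, hα⟩ : ∃ α, D.restrict μ α u ≠ 0 := by
    by_contra! hcon
    exact hu0 (D.eq_zero_of_restrict_eq_zero μ hcon)
  exact hasSum_lt hle (hlt α hα) hnorm hsum

/-- The projections of the restrictions of `u` to the cells where `V` is not above `l` onto the
Neumann eigenfunctions up to `l`. -/
def neumannMap (D : CellularDecomposition bK X ι) (μ : Measure K) (EK : NonnegForm (Lp ℝ 2 μ))
    (V : X → ℝ≥0) (l : ℝ) [FiniteDimensional ℝ (EK.lowSpace l)] :
    Lp ℝ 2 (D.gluedMeasure μ) →L[ℝ] ({α | (D.cellInf V α : ℝ) ≤ l} → EK.lowSpace l) :=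
  ContinuousLinearMap.pi fun α => (EK.lowSpace l).orthogonalProjectionOnto ∘L D.restrictL μ α

theorem restrict_mem_orthogonal_of_neumannMap_eq_zero {V : X → ℝ≥0} {l : ℝ}
    [FiniteDimensional ℝ (EK.lowSpace l)] {u : Lp ℝ 2 (D.gluedMeasure μ)}
    (h : D.neumannMap μ EK V l u = 0) (α : ι) (hα : (D.cellInf V α : ℝ) ≤ l) :
    D.restrict μ α u ∈ (EK.lowSpace l)ᗮ :=
  Submodule.orthogonalProjectionOnto_eq_zero_iff.1 (congrFun h ⟨α, hα⟩)

theorem count_schrodingerForm_le (hglue : D.IsGluedForm μ EK E) (hresN : EK.CompactResolvent)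
    {V : X → ℝ≥0} (hVm : Measurable V) {l : ℝ} (hfin : {α | (D.cellInf V α : ℝ) ≤ l}.Finite)
    [FiniteDimensional ℝ (EK.lowSpace l)] :
    (schrodingerForm E V hVm).count l ≤
      ({α | (D.cellInf V α : ℝ) ≤ l}.encard : ℝ≥0∞) * EK.count l := by
  have : Fintype {α | (D.cellInf V α : ℝ) ≤ l} := hfin.fintype
  have h := (schrodingerForm E V hVm).toENat_rank_lowSpace_le
    (D.neumannMap μ EK V l).toLinearMap fun u h h0 => lt_schrodingerForm hglue hresN hVm u
      (restrict_mem_orthogonal_of_neumannMap_eq_zero h) h0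
  rw [← Module.finrank_eq_rank ℝ ({α | (D.cellInf V α : ℝ) ≤ l} → EK.lowSpace l),
    Cardinal.toENat_nat, Module.finrank_pi_fintype, Finset.sum_const, Finset.card_univ,
    smul_eq_mul] at h
  rw [EK.count_eq_finrank, NonnegForm.count_eq, Set.encard_eq_coe_toFinset_card,
    Set.toFinset_card]
  exact_mod_cast ENat.toENNReal_le.2 h

theorem compactResolvent_schrodingerForm (hglue : D.IsGluedForm μ EK E)
    (hresN : EK.CompactResolvent) {V : X → ℝ≥0} (hVm : Measurable V)
    (hfin : ∀ l : ℝ, {α | (D.cellInf V α : ℝ) ≤ l}.Finite)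
    (hdim : ∀ l : ℝ, FiniteDimensional ℝ (EK.lowSpace l))
    (hcl : (schrodingerForm E V hVm).Closed) : (schrodingerForm E V hVm).CompactResolvent := by
  refine NonnegForm.compactResolvent_of_forall_finiteDimensional _ hcl fun l _ => ?_
  have : Fintype {α | (D.cellInf V α : ℝ) ≤ l} := (hfin l).fintype
  have := hdim l
  obtain ⟨M, hM, hMT⟩ := (D.neumannMap μ EK V l).exists_finiteDimensional_orthogonal_le_ker
  refine ⟨M, hM, fun u hu => ?_⟩
  by_cases hu0 : (u : Lp ℝ 2 (D.gluedMeasure μ)) = 0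
  · rw [hu0, norm_zero]
    simpa using (schrodingerForm E V hVm).nonneg u
  · exact (lt_schrodingerForm hglue hresN hVm u
      (restrict_mem_orthogonal_of_neumannMap_eq_zero (hMT u hu)) hu0).le

/-- The functions that are spanned by Dirichlet eigenfunctions up to `l` on each of the cells of
`A`, and vanish on the other cells. -/
def dirichletSpace (D : CellularDecomposition bK X ι) (μ : Measure K)
    (EK : NonnegForm (Lp ℝ 2 μ)) (A : Set ι) (l : ℝ) :
    Submodule ℝ (Lp ℝ 2 (D.gluedMeasure μ)) :=
  (⨅ α ∈ A, ((partForm EK bKᶜ).lowSpace l).comap (D.restrictL μ α).toLinearMap) ⊓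
    ⨅ α ∉ A, (D.restrictL μ α).ker

theorem mem_dirichletSpace {A : Set ι} {l : ℝ} {u : Lp ℝ 2 (D.gluedMeasure μ)} :
    u ∈ D.dirichletSpace μ EK A l ↔
      (∀ α ∈ A, D.restrict μ α u ∈ (partForm EK bKᶜ).lowSpace l) ∧
      ∀ α ∉ A, D.restrict μ α u = 0 := by
  simp [dirichletSpace, restrictL_apply]

/-- Prescribed restrictions to finitely many cells are attained. -/
theorem exists_restrict_eq [Countable ι] (hμ : μ bK = 0) {A : Set ι} [Fintype A]
    (s : A → Lp ℝ 2 μ) :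
    ∃ u : Lp ℝ 2 (D.gluedMeasure μ), (∀ α : A, D.restrict μ α u = s α) ∧
      ∀ α ∉ A, D.restrict μ α u = 0 := by
  classical
  choose e he he' using fun α : A => D.exists_extension μ hμ α (s α)
  have h : ∀ β, D.restrict μ β (∑ α, e α) = ∑ α, D.restrict μ β (e α) := fun β =>
    map_sum (D.restrictL μ β) e Finset.univ
  refine ⟨∑ α, e α, fun β => ?_, fun β hβ => ?_⟩
  · rw [h, Finset.sum_eq_single β, he]
    · intro α _ hα
      exact he' α β fun hβα => hα (Subtype.ext hβα.symm)
    · simp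
  · rw [h]
    exact Finset.sum_eq_zero fun α _ => he' α β fun hβα => hβ (hβα ▸ α.2)

theorem mem_domain_of_mem_dirichletSpace [Countable ι] (hμ : μ bK = 0)
    (hglue : D.IsGluedForm μ EK E) {A : Set ι} [Fintype A] {l : ℝ}
    {u : Lp ℝ 2 (D.gluedMeasure μ)} (hu : u ∈ D.dirichletSpace μ EK A l) : u ∈ E.domain := by
  classical
  obtain ⟨hu1, hu2⟩ := mem_dirichletSpace.1 hu
  choose e he he' using fun α : A => D.exists_extension μ hμ α (D.restrict μ α u)
  have heq : u - ∑ α, e α = 0 := by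
    refine D.eq_zero_of_restrict_eq_zero μ fun β => ?_
    rw [← restrictL_apply, map_sub, map_sum, restrictL_apply]
    by_cases hβ : β ∈ A
    · have h1 : D.restrict μ β (e ⟨β, hβ⟩) = D.restrict μ β u := he ⟨β, hβ⟩
      rw [Finset.sum_eq_single ⟨β, hβ⟩, restrictL_apply, h1, sub_self]
      · intro α _ hα
        exact he' α β fun hβα => hα (Subtype.ext hβα.symm)
      · simp
    · rw [hu2 β hβ, Finset.sum_eq_zero, sub_zero]
      intro α _
      exact he' α β fun hβα => hβ (hβα ▸ α.2)
  rw [sub_eq_zero.1 heq]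
  refine E.domain.sum_mem fun α _ => hglue.extend_mem (e α) α ?_ (he' α)
  rw [he]
  exact ((partForm EK bKᶜ).form_le_of_mem_lowSpace (hu1 α α.2)).1

/-- Dirichlet bracketing: on the cells where `V ≤ l`, the Dirichlet eigenfunctions up to `l`
extended by zero span a space on which the Schrödinger form is at most `2 l ‖u‖²`. -/
theorem schrodingerForm_le_of_mem_dirichletSpace [Countable ι] (hμ : μ bK = 0)
    (hglue : D.IsGluedForm μ EK E) {V : X → ℝ≥0} (hVm : Measurable V)
    (hVb : ∀ x, ∃ U ∈ 𝓝 x, BddAbove (V '' U)) {l : ℝ}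
    [Fintype {α | (D.cellSup V α : ℝ) ≤ l}] {u : Lp ℝ 2 (D.gluedMeasure μ)}
    (hu : u ∈ D.dirichletSpace μ EK {α | (D.cellSup V α : ℝ) ≤ l} l) :
    ∃ h : u ∈ (schrodingerForm E V hVm).domain,
      (schrodingerForm E V hVm).form ⟨u, h⟩ ⟨u, h⟩ ≤ 2 * l * ‖u‖ ^ 2 := by
  have huE := mem_domain_of_mem_dirichletSpace hμ hglue hu
  obtain ⟨hu1, hu2⟩ := mem_dirichletSpace.1 hu
  have hae : ∀ᵐ x ∂D.gluedMeasure μ, (V x : ℝ) * u x ^ 2 ≤ l * u x ^ 2 := by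
    refine (D.ae_gluedMeasure_iff μ).2 fun α => ?_
    by_cases hα : (D.cellSup V α : ℝ) ≤ l
    · exact Eventually.of_forall fun y => mul_le_mul_of_nonneg_right
        ((NNReal.coe_le_coe.2 (D.le_cellSup hVb α y)).trans hα) (sq_nonneg _)
    · filter_upwards [D.coeFn_restrict μ α u, Lp.coeFn_zero ℝ 2 μ] with y h1 h2
      rw [hu2 α hα, h2] at h1
      rw [← h1]
      simp
  obtain ⟨huV, hle⟩ := mem_potentialDomain_of_bound hVm hae
  refine ⟨⟨huE, huV⟩, ?_⟩
  have hE : E.form ⟨u, huE⟩ ⟨u, huE⟩ ≤ l * ‖u‖ ^ 2 := by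
    refine hasSum_le (fun α => ?_) (hglue.energy ⟨u, huE⟩ ⟨u, huE⟩)
      ((D.hasSum_norm_sq_restrict μ u).mul_left l)
    by_cases hα : (D.cellSup V α : ℝ) ≤ l
    · exact ((partForm EK bKᶜ).form_le_of_mem_lowSpace (hu1 α hα)).2
    · have h0 : (⟨D.restrict μ α u, hglue.restrict_mem u huE α⟩ : EK.domain) = 0 :=
        Subtype.ext (hu2 α hα)
      have h1 : EK.form ⟨D.restrict μ α u, hglue.restrict_mem u huE α⟩
          ⟨D.restrict μ α u, hglue.restrict_mem u huE α⟩ = 0 := by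
        rw [h0, map_zero]
      refine h1.le.trans ?_
      rw [hu2 α hα, norm_zero, zero_pow two_ne_zero, mul_zero]
  calc (schrodingerForm E V hVm).form ⟨u, huE, huV⟩ ⟨u, huE, huV⟩
      = E.form ⟨u, huE⟩ ⟨u, huE⟩ + (potentialForm _ V hVm).form ⟨u, huV⟩ ⟨u, huV⟩ := rfl
    _ ≤ 2 * l * ‖u‖ ^ 2 := by linarith

theorem le_count_schrodingerForm [Countable ι] (hμ : μ bK = 0)
    (hglue : D.IsGluedForm μ EK E) {V : X → ℝ≥0} (hVm : Measurable V)
    (hVb : ∀ x, ∃ U ∈ 𝓝 x, BddAbove (V '' U))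
    (hres : (schrodingerForm E V hVm).CompactResolvent) {l : ℝ}
    (hfin : {α | (D.cellSup V α : ℝ) ≤ l}.Finite)
    [FiniteDimensional ℝ ((partForm EK bKᶜ).lowSpace l)]
    [FiniteDimensional ℝ ((schrodingerForm E V hVm).lowSpace (2 * l))] :
    ({α | (D.cellSup V α : ℝ) ≤ l}.encard : ℝ≥0∞) * (partForm EK bKᶜ).count l ≤
      (schrodingerForm E V hVm).count (2 * l) := by
  set A : Set ι := {α | (D.cellSup V α : ℝ) ≤ l} with hA
  have : Fintype A := hfin.fintype
  set S := (partForm EK bKᶜ).lowSpace l with hS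
  have h1 := (schrodingerForm E V hVm).rank_le_rank_lowSpace hres (l := 2 * l)
    (D.dirichletSpace μ EK A l)
    fun u hu => schrodingerForm_le_of_mem_dirichletSpace hμ hglue hVm hVb hu
  have : FiniteDimensional ℝ (D.dirichletSpace μ EK A l) :=
    Module.rank_lt_aleph0_iff.1 (h1.trans_lt (Module.rank_lt_aleph0 _ _))
  have h2 : Module.finrank ℝ (D.dirichletSpace μ EK A l) ≤
      Module.finrank ℝ ((schrodingerForm E V hVm).lowSpace (2 * l)) :=
    Module.finrank_le_finrank_of_rank_le_rank (by simpa using h1) (Module.rank_lt_aleph0 _ _)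
  let R : D.dirichletSpace μ EK A l →ₗ[ℝ] (A → S) :=
    LinearMap.pi fun α => LinearMap.codRestrict S
      ((D.restrictL μ α).toLinearMap ∘ₗ (D.dirichletSpace μ EK A l).subtype)
      fun u => (mem_dirichletSpace.1 u.2).1 α α.2
  have hR : Function.Surjective R := by
    intro s
    obtain ⟨u, hu, hu'⟩ := exists_restrict_eq (D := D) hμ fun α : A => (s α : Lp ℝ 2 μ)
    refine ⟨⟨u, mem_dirichletSpace.2 ⟨fun α hα => ?_, hu'⟩⟩, funext fun α => Subtype.ext (hu α)⟩
    rw [hu ⟨α, hα⟩]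
    exact (s ⟨α, hα⟩).2
  have h3 := LinearMap.finrank_le_finrank_of_surjective hR
  rw [Module.finrank_pi_fintype, Finset.sum_const, Finset.card_univ, smul_eq_mul] at h3
  rw [NonnegForm.count_eq_finrank, NonnegForm.count_eq_finrank, Set.encard_eq_coe_toFinset_card,
    Set.toFinset_card]
  exact_mod_cast h3.trans h2

end CellularDecomposition

/-! ### Comparability at infinity -/

theorem Comparable.exists_lower {f g : ℝ → ℝ≥0∞} (h : Comparable f g) :
    ∃ c : ℝ≥0∞, 0 < c ∧ c ≠ ⊤ ∧ ∀ᶠ l in atTop, c * g l ≤ f l := by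
  obtain ⟨c, hc0, hc⟩ := exists_between h.1
  refine ⟨c, hc0, hc.ne_top, ?_⟩
  filter_upwards [eventually_lt_of_lt_liminf hc] with l hl using ENNReal.mul_le_of_le_div hl.le

theorem Comparable.exists_upper {f g : ℝ → ℝ≥0∞} (h : Comparable f g) :
    ∃ C : ℝ≥0∞, C ≠ ⊤ ∧ ∀ᶠ l in atTop, f l ≤ C * g l := by
  obtain ⟨C, hC, hC'⟩ := exists_between h.2
  refine ⟨C, hC'.ne, ?_⟩
  filter_upwards [eventually_lt_of_limsup_lt hC] with l hl
  exact (ENNReal.div_le_iff_le_mul (Or.inr hC'.ne) (Or.inr (pos_of_gt hC).ne')).1 hl.le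

theorem comparable_of_bounds {f g : ℝ → ℝ≥0∞} {c C : ℝ≥0∞} (hc : c ≠ 0) (hC : C ≠ ⊤)
    (h1 : ∀ᶠ l in atTop, c * g l ≤ f l) (h2 : ∀ᶠ l in atTop, f l ≤ C * g l)
    (h0 : ∀ᶠ l in atTop, g l ≠ 0) (ht : ∀ᶠ l in atTop, g l ≠ ⊤) : Comparable f g := by
  constructor
  · refine (pos_iff_ne_zero.2 hc).trans_le (le_liminf_of_le ?_ ?_)
    · isBoundedDefault
    · filter_upwards [h1, h0, ht] with l h1 h0 ht
      exact (ENNReal.le_div_iff_mul_le (Or.inl h0) (Or.inl ht)).2 h1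
  · refine (limsup_le_of_le ?_ ?_).trans_lt hC.lt_top
    · isBoundedDefault
    · filter_upwards [h2, h0, ht] with l h2 h0 ht
      exact (ENNReal.div_le_iff_le_mul (Or.inl h0) (Or.inl ht)).2 h2

/-- A counting function that is comparable to a power takes finite values only. -/
theorem NonnegForm.finiteDimensional_lowSpace_of_comparable {H : Type*} [NormedAddCommGroup H]
    [InnerProductSpace ℝ H] {E : NonnegForm H} {s : ℝ}
    (h : Comparable E.count fun l => ENNReal.ofReal (l ^ s)) (l : ℝ) :
    FiniteDimensional ℝ (E.lowSpace l) := by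
  obtain ⟨C, hC, h⟩ := h.exists_upper
  obtain ⟨l', hl', hll'⟩ := (h.and (eventually_ge_atTop l)).exists
  refine E.finiteDimensional_lowSpace (ne_top_of_le_ne_top ?_ ((E.count_mono hll').trans hl'))
  exact ENNReal.mul_ne_top hC ENNReal.ofReal_ne_top

theorem distFn_mono {X : Type*} [MeasurableSpace X] (m : Measure X) (V : X → ℝ≥0) :
    Monotone (distFn m V) := fun _ _ h => measure_mono fun _ hx => le_trans hx h

/-- If `f` is comparable to `l ^ a * F` and `F` to `l ^ b`, then `f` is comparable to
`l ^ (a + b)`. -/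
theorem Comparable.rpow_add {f F : ℝ → ℝ≥0∞} {a b : ℝ}
    (hf : Comparable f fun l => ENNReal.ofReal (l ^ a) * F l)
    (hF : Comparable F fun l => ENNReal.ofReal (l ^ b)) :
    Comparable f fun l => ENNReal.ofReal (l ^ (a + b)) := by
  obtain ⟨c₁, hc₁, -, h1⟩ := hf.exists_lower
  obtain ⟨C₁, hC₁, h2⟩ := hf.exists_upper
  obtain ⟨c₂, hc₂, -, h3⟩ := hF.exists_lower
  obtain ⟨C₂, hC₂, h4⟩ := hF.exists_upper
  have hpow : ∀ᶠ l : ℝ in atTop, ENNReal.ofReal (l ^ (a + b)) =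
      ENNReal.ofReal (l ^ a) * ENNReal.ofReal (l ^ b) := by
    filter_upwards [eventually_gt_atTop 0] with l hl
    rw [← ENNReal.ofReal_mul (by positivity), ← Real.rpow_add hl]
  refine comparable_of_bounds (c := c₁ * c₂) (C := C₁ * C₂) (mul_ne_zero hc₁.ne' hc₂.ne')
    (ENNReal.mul_ne_top hC₁ hC₂) ?_ ?_ ?_ (Eventually.of_forall fun _ => ENNReal.ofReal_ne_top)
  · filter_upwards [h1, h3, hpow] with l h1 h3 h5
    calc c₁ * c₂ * ENNReal.ofReal (l ^ (a + b))
        = c₁ * (ENNReal.ofReal (l ^ a) * (c₂ * ENNReal.ofReal (l ^ b))) := by rw [h5]; ring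
      _ ≤ c₁ * (ENNReal.ofReal (l ^ a) * F l) := by gcongr
      _ ≤ f l := h1
  · filter_upwards [h2, h4, hpow] with l h2 h4 h5
    calc f l ≤ C₁ * (ENNReal.ofReal (l ^ a) * F l) := h2
      _ ≤ C₁ * (ENNReal.ofReal (l ^ a) * (C₂ * ENNReal.ofReal (l ^ b))) := by gcongr
      _ = C₁ * C₂ * ENNReal.ofReal (l ^ (a + b)) := by rw [h5]; ring
  · filter_upwards [eventually_gt_atTop 0] with l hl
    exact (ENNReal.ofReal_pos.2 (Real.rpow_pos_of_pos hl _)).ne'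

/-- The bracketing bounds `Fu l * ND l ≤ N (2 l)` and `N l ≤ Fl l * NN l` and the doubling
condition `Fl (2 l) ≤ C Fu l` make `N` comparable to `l ^ s * F` for `Fu ≤ F ≤ Fl`: both bounds
are taken between `l / 2` and `l`. -/
theorem comparable_of_bracketing {N NN ND F Fu Fl : ℝ → ℝ≥0∞} {s : ℝ} {C : ℝ≥0} (hC : 0 < C)
    (hNN : Comparable NN fun l => ENNReal.ofReal (l ^ s))
    (hND : Comparable ND fun l => ENNReal.ofReal (l ^ s))
    (hup : ∀ l, N l ≤ Fl l * NN l) (hlow : ∀ l, Fu l * ND l ≤ N (2 * l))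
    (hFl : ∀ l, F l ≤ Fl l) (hFu : ∀ l, Fu l ≤ F l) (hmono : Monotone Fu)
    (hdoubling : ∀ᶠ l in atTop, Fl (2 * l) ≤ C * Fu l)
    (hF0 : ∀ᶠ l in atTop, F l ≠ 0) (hFt : ∀ l, F l ≠ ⊤) :
    Comparable N fun l => ENNReal.ofReal (l ^ s) * F l := by
  obtain ⟨CN, hCN, hN⟩ := hNN.exists_upper
  obtain ⟨cD, hcD0, -, hD⟩ := hND.exists_lower
  have hC0 : (C : ℝ≥0∞) ≠ 0 := ENNReal.coe_ne_zero.2 hC.ne'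
  have hhalf : Tendsto (fun l : ℝ => l / 2) atTop atTop := tendsto_id.atTop_div_const two_pos
  have hdouble : ∀ᶠ l in atTop, Fl l ≤ C * Fu (l / 2) := by
    filter_upwards [hhalf.eventually hdoubling] with l hl
    rwa [mul_div_cancel₀ l two_ne_zero] at hl
  set k : ℝ≥0∞ := ENNReal.ofReal ((1 / 2) ^ s) with hk
  have hk0 : k ≠ 0 := (ENNReal.ofReal_pos.2 (by positivity)).ne'
  have hpk : ∀ᶠ l : ℝ in atTop, ENNReal.ofReal ((l / 2) ^ s) = k * ENNReal.ofReal (l ^ s) := by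
    filter_upwards [eventually_gt_atTop 0] with l hl
    rw [hk, ← ENNReal.ofReal_mul (by positivity), ← Real.mul_rpow (by positivity) hl.le,
      one_div_mul_eq_div]
  refine comparable_of_bounds (c := cD * k / C) (C := C * CN)
    (ENNReal.div_ne_zero.2 ⟨mul_ne_zero hcD0.ne' hk0, ENNReal.coe_ne_top⟩)
    (ENNReal.mul_ne_top ENNReal.coe_ne_top hCN) ?_ ?_ ?_
    (Eventually.of_forall fun l => ENNReal.mul_ne_top ENNReal.ofReal_ne_top (hFt l))
  · filter_upwards [hhalf.eventually hD, hdouble, hpk] with l h1 h2 h3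
    have h4 := hlow (l / 2)
    rw [mul_div_cancel₀ l two_ne_zero] at h4
    calc cD * k / C * (ENNReal.ofReal (l ^ s) * F l)
        ≤ cD * k / C * (ENNReal.ofReal (l ^ s) * (C * Fu (l / 2))) := by
          gcongr
          exact (hFl l).trans h2
      _ = (C * (C : ℝ≥0∞)⁻¹) * (Fu (l / 2) * (cD * (k * ENNReal.ofReal (l ^ s)))) := by
          rw [ENNReal.div_eq_inv_mul]
          ring
      _ = Fu (l / 2) * (cD * ENNReal.ofReal ((l / 2) ^ s)) := by
          rw [ENNReal.mul_inv_cancel hC0 ENNReal.coe_ne_top, one_mul, h3]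
      _ ≤ Fu (l / 2) * ND (l / 2) := by gcongr
      _ ≤ N l := h4
  · filter_upwards [hN, hdouble, eventually_ge_atTop 0] with l h1 h2 h3
    calc N l ≤ Fl l * NN l := hup l
      _ ≤ C * F l * (CN * ENNReal.ofReal (l ^ s)) := by
          gcongr
          refine h2.trans ?_
          gcongr
          exact (hmono (half_le_self h3)).trans (hFu l)
      _ = C * CN * (ENNReal.ofReal (l ^ s) * F l) := by ring
  · filter_upwards [eventually_gt_atTop 0, hF0] with l h1 h2
    exact mul_ne_zero (ENNReal.ofReal_pos.2 (Real.rpow_pos_of_pos h1 _)).ne' h2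

end

theorem theorem2p1
    {K : Type*} [MetricSpace K] [CompactSpace K] [MeasurableSpace K] [BorelSpace K]
    {X : Type*} [MetricSpace X] [MeasurableSpace X] [BorelSpace X] {ι : Type*}
    -- the cell, its measure and its boundary
    (μ : Measure K) [IsProbabilityMeasure μ] (bK : Set K) (hbK : IsClosed bK) (hμ : μ bK = 0)
    -- the Neumann Laplacian of the cell; the Dirichlet Laplacian is its part off the boundary
    (EK : NonnegForm (Lp ℝ 2 μ)) (hEK : IsLaplacianForm EK)
    (hresN : EK.CompactResolvent) (hresD : (partForm EK bKᶜ).CompactResolvent)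
    -- two-sided bounds for the counting functions of the cell
    (dₛ : ℝ) (hdₛ : 0 < dₛ)
    (hN : Comparable EK.count (fun l => ENNReal.ofReal (l ^ (dₛ / 2))))
    (hD : Comparable (partForm EK bKᶜ).count (fun l => ENNReal.ofReal (l ^ (dₛ / 2))))
    -- the unbounded space, its measure and its Laplacian
    (D : CellularDecomposition bK X ι) (o : X)
    (hfin : ∀ r : ℝ, D.gluedMeasure μ (Metric.ball o r) < ⊤)
    (E : NonnegForm (Lp ℝ 2 (D.gluedMeasure μ))) (hE : IsLaplacianForm E)
    (hglue : D.IsGluedForm μ EK E)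
    -- the potential
    (V : X → ℝ≥0) (hVm : Measurable V) (hVb : ∀ x, ∃ U ∈ 𝓝 x, BddAbove (V '' U))
    (hVinf : Tendsto V (comap (fun x => dist o x) atTop) atTop)
    (hVF : ∃ C : ℝ≥0, 0 < C ∧ ∀ᶠ l : ℝ in atTop,
      distFn (D.gluedMeasure μ) (D.lower V) (2 * l) ≤
        C * distFn (D.gluedMeasure μ) (D.upper V) l) :
    -- the Schrödinger operator is self-adjoint with discrete spectrum
    ((schrodingerForm E V hVm).DenselyDefinedClosed ∧
      (schrodingerForm E V hVm).CompactResolvent) ∧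
    -- the counting function is comparable to the phase space volume
    Comparable (schrodingerForm E V hVm).count
      (fun l => ENNReal.ofReal (l ^ (dₛ / 2)) * distFn (D.gluedMeasure μ) V l) ∧
    -- the spectral dimension
    ∀ β : ℝ,
      Comparable (distFn (D.gluedMeasure μ) V) (fun l => ENNReal.ofReal (l ^ β)) →
      Comparable (schrodingerForm E V hVm).count
        (fun l => ENNReal.ofReal (l ^ ((dₛ + 2 * β) / 2))) := by
  have hcount : Countable ι := D.countable_cells μ o hfin
  have hinf := D.finite_cellInf_le μ o hfin hVinf
  have hsup := D.finite_cellSup_le μ o hfin hVb hVinf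
  have hdimN := NonnegForm.finiteDimensional_lowSpace_of_comparable hN
  have hdimD := NonnegForm.finiteDimensional_lowSpace_of_comparable hD
  have hclosed := denselyDefinedClosed_schrodingerForm hE hVm hVb
  have hres := CellularDecomposition.compactResolvent_schrodingerForm hglue hresN hVm hinf hdimN
    hclosed.2
  have hdim : ∀ l, FiniteDimensional ℝ ((schrodingerForm E V hVm).lowSpace l) := fun l => by
    have := hdimN l
    refine NonnegForm.finiteDimensional_lowSpace _ (ne_top_of_le_ne_top ?_
      (CellularDecomposition.count_schrodingerForm_le hglue hresN hVm (hinf l)))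
    rw [EK.count_eq_finrank]
    exact ENNReal.mul_ne_top (by simpa using hinf l) (ENNReal.natCast_ne_top _)
  obtain ⟨C, hC, hCF⟩ := hVF
  have hmain : Comparable (schrodingerForm E V hVm).count
      fun l => ENNReal.ofReal (l ^ (dₛ / 2)) * distFn (D.gluedMeasure μ) V l := by
    refine comparable_of_bracketing hC hN hD (fun l => ?_) (fun l => ?_)
      (D.distFn_le_distFn_lower μ hμ V) (D.distFn_upper_le_distFn μ hμ hVb) (distFn_mono _ _)
      hCF ?_ (fun l => ?_)
    · have := hdimN l
      rw [D.distFn_lower μ hμ]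
      exact CellularDecomposition.count_schrodingerForm_le hglue hresN hVm (hinf l)
    · have := hdimD l
      have := hdim (2 * l)
      rw [D.distFn_upper μ hμ]
      exact CellularDecomposition.le_count_schrodingerForm hμ hglue hVm hVb hres (hsup l)
    · obtain ⟨α, -⟩ := Set.mem_iUnion.1 (D.cover ▸ Set.mem_univ o)
      filter_upwards [eventually_ge_atTop (D.cellSup V α : ℝ)] with l hl h0
      have h1 := D.distFn_upper_le_distFn μ hμ hVb l
      rw [h0, D.distFn_upper μ hμ, nonpos_iff_eq_zero] at h1
      have h2 : {α | (D.cellSup V α : ℝ) ≤ l} = ∅ := by simpa using h1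
      exact Set.notMem_empty α (h2 ▸ hl)
    · refine ne_top_of_le_ne_top ?_ (D.distFn_le_distFn_lower μ hμ V l)
      rw [D.distFn_lower μ hμ]
      simpa using hinf l
  refine ⟨⟨hclosed, hres⟩, hmain, fun β hβ => ?_⟩
  have hexp : (dₛ + 2 * β) / 2 = dₛ / 2 + β := by ring
  rw [hexp]
  exact hmain.rpow_add hβ
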